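/- Let $X$ be a set, let $(Y,\mathcal Y)$ be a measurable space, let $\mathcal P(\mathcal Y)$ be the set of probability measures on it, and let $W:X\to\mathcal P(\mathcal Y)$ be any function (a channel). For $w,q\in\mathcal P(\mathcal Y)$ and $\alpha\in(0,1]$ let $D_\alpha(w\|q)\in[0,\infty]$ be the order $\alpha$ Rényi divergence: $D_\alpha(w\|q)=\frac{1}{\alpha-1}\ln\int\left(\frac{dw}{d\nu}\right)^{\alpha}\left(\frac{dq}{d\nu}\right)^{1-\alpha}d\nu$ for $\alpha\neq 1$, where $\nu$ is any $\sigma$-finite measure dominating $w$ and $q$, and $D_1(w\|q)=\int\ln\frac{dw}{dq}\,dw$ if $w\ll q$ and $D_1(w\|q)=\infty$ otherwise (the Kullback–Leibler divergence). For a finitely supported probability mass function $P$ on $X$ and $Q\in\mathcal P(\mathcal Y)$ let $$D_\alpha(W\|Q|P)=\sum_{x}P(x)\,D_\alpha(W(x)\|Q),$$ the sum being over the support of $P$. For a set $A$ of finitely supported probability mass functions on $X$ the order $\alpha$ Augustin capacity of $W$ for the constraint set $A$ is $$C_{\alpha,W,A}=\sup_{P\in A}\ \inf_{Q\in\mathcal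 P(\mathcal Y)}D_\alpha(W\|Q|P).$$ **Lemma (Erven–Harremoës bound for the Augustin capacity).** Let $\alpha\in(0,1]$ and let $A$ be a nonempty convex set of finitely supported probability mass functions on $X$ with $C_{\alpha,W,A}<\infty$. Then there is a unique $q_{\alpha,W,A}\in\mathcal P(\mathcal Y)$, called the order $\alpha$ Augustin center of $W$ for the constraint set $A$, such that $$C_{\alpha,W,A}=\sup_{P\in A}D_\alpha(W\|q_{\alpha,W,A}|P),$$ and for every $Q\in\mathcal P(\mathcal Y)$ $$\sup_{P\in A}D_\alpha(W\|Q|P)\ \ge\ C_{\alpha,W,A}+D_\alpha(q_{\alpha,W,A}\|Q).$$ -/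

import Mathlib

open MeasureTheory
open scoped ENNReal

namespace Augustin

noncomputable section

/-- The order `α` Rényi divergence `D_α(w‖q)` of probability measures, with values in `[-∞, ∞]`
and the natural logarithm.

For `α ≠ 1` it is `(α - 1)⁻¹ ln ∫ (dw/dν)^α (dq/dν)^(1-α) dν` with the dominating measure
`ν = w + q` (the integral is the same for every `σ`-finite `ν` that dominates `w` and `q`);
`ENNReal.log` sends `0` to `-∞`, so the value is `+∞` for mutually singular `w`, `q` when `α < 1`.
For `α = 1` it is the Kullback-Leibler divergence. -/
def renyiDiv {Y : Type*} [MeasurableSpace Y] (α : ℝ) (w q : ProbabilityMeasure Y) : EReal :=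
  if α = 1 then
    (InformationTheory.klDiv (w : Measure Y) (q : Measure Y) : EReal)
  else
    (((α - 1)⁻¹ : ℝ) : EReal) *
      ENNReal.log (∫⁻ y,
        ((w : Measure Y).rnDeriv ((w : Measure Y) + (q : Measure Y)) y) ^ α *
        ((q : Measure Y).rnDeriv ((w : Measure Y) + (q : Measure Y)) y) ^ (1 - α)
        ∂((w : Measure Y) + (q : Measure Y)))

/-- The set of probability mass functions on `X` that are non-zero at finitely many points only. -/
def finPMF (X : Type*) : Set (X →₀ ℝ) :=
  {P | (∀ x, 0 ≤ P x) ∧ P.sum (fun _ p => p) = 1}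

/-- The conditional Rényi divergence `D_α(W‖Q|P) = ∑ₓ P(x) D_α(W(x)‖Q)`. The sum runs over the
support of `P`. -/
def condRenyiDiv {X Y : Type*} [MeasurableSpace Y] (α : ℝ) (W : X → ProbabilityMeasure Y)
    (Q : ProbabilityMeasure Y) (P : X →₀ ℝ) : EReal :=
  P.sum fun x p => (p : EReal) * renyiDiv α (W x) Q

/-- The order `α` Augustin information `I_α(P; W) = inf_Q D_α(W‖Q|P)`. -/
def augustinInformation {X Y : Type*} [MeasurableSpace Y] (α : ℝ)
    (W : X → ProbabilityMeasure Y) (P : X →₀ ℝ) : EReal :=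
  ⨅ Q : ProbabilityMeasure Y, condRenyiDiv α W Q P

/-- The order `α` Augustin capacity `C_{α,W,A} = sup_{P ∈ A} I_α(P; W)`. -/
def augustinCapacity {X Y : Type*} [MeasurableSpace Y] (α : ℝ)
    (W : X → ProbabilityMeasure Y) (A : Set (X →₀ ℝ)) : EReal :=
  ⨆ P ∈ A, augustinInformation α W P

/-- `q` is an order `α` Augustin center of `W` for the constraint set `A`:
`C_{α,W,A} = sup_{P ∈ A} D_α(W‖q|P)`. -/
def IsAugustinCenter {X Y : Type*} [MeasurableSpace Y] (α : ℝ)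
    (W : X → ProbabilityMeasure Y) (A : Set (X →₀ ℝ)) (q : ProbabilityMeasure Y) : Prop :=
  augustinCapacity α W A = ⨆ P ∈ A, condRenyiDiv α W q P

end

end Augustin

namespace Augustin

open Filter Topology InformationTheory

variable {Y : Type*} [MeasurableSpace Y]

/-! The core is the bound for one input distribution: if its Augustin information I(P) is finite,
some mean q satisfies I(P) + D(q‖Q) ≤ D(W‖Q|P) for all Q (`exists_mean_info`). For α = 1 the mixture
∑ P(x) W(x) works, by the compensation inequality. For α < 1 no minimising Q is needed. The vectors
of affinities ∫ w_x^α Q^(1-α) lie in a finite-dimensional cube, and some t in their closure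
maximises the geometric mean with weights P(x). Affinity is concave in Q, so the first order
condition at t is ∑ P(x) aff(W(x), Q) / t(x) ≤ 1 for every Q. The left side equals z^α aff(q, Q),
where q has density proportional to (∑ (P(x)/t(x)) w_x^α)^(1/α). Taking Q = q gives z^α ≤ 1, and
Jensen's inequality for the logarithm gives the bound.

For the set A, take P_n ∈ A with information tending to the capacity C, with means q_n. Convexity of
A bounds the information of a mixture of P_n with another member of A by C; a nearly optimal Q for
that mixture is then controlled by the bound at P_n (`exists_near_optimal`). Equal weights put q_n
and q_m close to a common Q, so (q_n) is Hellinger Cauchy, with a limit q'. For fixed P ∈ A, weights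
l → 0 and optimality errors o(l) make these Q converge to q' while D(W‖Q|P) ≤ C + o(1). Lower
semicontinuity in the second argument gives D(W‖q'|P) ≤ C, and in the first argument it carries the
Erven–Harremoës bound to q'. Applying that bound to another center gives uniqueness.

All orders are treated together by writing D as a continuous monotone function of the integral of a
nonnegative homogeneous integrand, `gapFun`. This integrand dominates a multiple of the squared
Hellinger integrand, and Fatou's lemma gives the semicontinuity. -/

/-! ### Densities and integrals independent of the dominating measure -/

/-- The density of `p` with respect to `ν`, as a real-valued function. -/
noncomputable def dens (ν p : Measure Y) (y : Y) : ℝ := (p.rnDeriv ν y).toReal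

lemma dens_nonneg (ν p : Measure Y) (y : Y) : 0 ≤ dens ν p y := ENNReal.toReal_nonneg

@[fun_prop]
lemma measurable_dens (ν p : Measure Y) : Measurable (dens ν p) :=
  (Measure.measurable_rnDeriv p ν).ennreal_toReal

lemma ofReal_dens_ae_eq (ν p : Measure Y) [IsFiniteMeasure p] :
    (fun y => ENNReal.ofReal (dens ν p y)) =ᵐ[ν] p.rnDeriv ν := by
  filter_upwards [p.rnDeriv_ne_top ν] with y hy
  simp [dens, ENNReal.ofReal_toReal hy]

lemma withDensity_dens {ν p : Measure Y} [IsFiniteMeasure ν] [IsFiniteMeasure p] (h : p ≪ ν) :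
    ν.withDensity (fun y => ENNReal.ofReal (dens ν p y)) = p := by
  rw [withDensity_congr_ae (ofReal_dens_ae_eq ν p), Measure.withDensity_rnDeriv_eq p ν h]

lemma lintegral_dens {ν p : Measure Y} [IsFiniteMeasure ν] [IsFiniteMeasure p] (h : p ≪ ν) :
    ∫⁻ y, ENNReal.ofReal (dens ν p y) ∂ν = p Set.univ := by
  rw [lintegral_congr_ae (ofReal_dens_ae_eq ν p), Measure.lintegral_rnDeriv h]

lemma lintegral_dens_mul {ν p : Measure Y} [IsFiniteMeasure ν] [IsFiniteMeasure p] (h : p ≪ ν)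
    {f : Y → ℝ≥0∞} (hf : Measurable f) :
    ∫⁻ y, ENNReal.ofReal (dens ν p y) * f y ∂ν = ∫⁻ y, f y ∂p := by
  rw [← lintegral_rnDeriv_mul h hf.aemeasurable]
  refine lintegral_congr_ae ?_
  filter_upwards [ofReal_dens_ae_eq ν p] with y hy
  rw [hy]

lemma dens_chain {ν ν' p : Measure Y} [IsFiniteMeasure ν] [IsFiniteMeasure ν'] [IsFiniteMeasure p]
    (h : p ≪ ν) : ∀ᵐ y ∂ν', dens ν' p y = dens ν' ν y * dens ν p y := by
  filter_upwards [Measure.rnDeriv_mul_rnDeriv (κ := ν') h] with y hy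
  rw [dens, ← hy, Pi.mul_apply, ENNReal.toReal_mul, mul_comm]; rfl

lemma dens_withDensity (ν : Measure Y) [IsFiniteMeasure ν] {f : Y → ℝ} (hf : Measurable f)
    (hf0 : ∀ y, 0 ≤ f y) :
    ∀ᵐ y ∂ν, dens ν (ν.withDensity fun y => ENNReal.ofReal (f y)) y = f y := by
  filter_upwards [Measure.rnDeriv_withDensity ν hf.ennreal_ofReal] with y hy
  rw [dens, hy, ENNReal.toReal_ofReal (hf0 y)]

lemma dens_add_smul (ν p q : Measure Y) [IsFiniteMeasure ν] [IsFiniteMeasure p] [IsFiniteMeasure q]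
    {a b : ℝ} (ha : 0 ≤ a) (hb : 0 ≤ b) :
    ∀ᵐ y ∂ν, dens ν (ENNReal.ofReal a • p + ENNReal.ofReal b • q) y =
      a * dens ν p y + b * dens ν q y := by
  have : IsFiniteMeasure (ENNReal.ofReal a • p) := p.smul_finite ENNReal.ofReal_ne_top
  have : IsFiniteMeasure (ENNReal.ofReal b • q) := q.smul_finite ENNReal.ofReal_ne_top
  filter_upwards [Measure.rnDeriv_add (ENNReal.ofReal a • p) (ENNReal.ofReal b • q) ν,
    Measure.rnDeriv_smul_left_of_ne_top p ν (r := ENNReal.ofReal a) ENNReal.ofReal_ne_top,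
    Measure.rnDeriv_smul_left_of_ne_top q ν (r := ENNReal.ofReal b) ENNReal.ofReal_ne_top,
    p.rnDeriv_ne_top ν, q.rnDeriv_ne_top ν] with y h1 h2 h3 h4 h5
  rw [dens, h1, Pi.add_apply, h2, h3]
  simp only [Pi.smul_apply, smul_eq_mul]
  rw [ENNReal.toReal_add (ENNReal.mul_ne_top ENNReal.ofReal_ne_top h4)
    (ENNReal.mul_ne_top ENNReal.ofReal_ne_top h5), ENNReal.toReal_mul, ENNReal.toReal_mul,
    ENNReal.toReal_ofReal ha, ENNReal.toReal_ofReal hb]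
  rfl

/-- Positive homogeneity of degree one on the closed quadrant. -/
def PosHomogeneous (φ : ℝ → ℝ → ℝ≥0∞) : Prop :=
  ∀ c a b : ℝ, 0 ≤ c → 0 ≤ a → 0 ≤ b → φ (c * a) (c * b) = ENNReal.ofReal c * φ a b

/-- The integral of `φ (dp/dν) (dq/dν)` with respect to `ν`. -/
noncomputable def persp (φ : ℝ → ℝ → ℝ≥0∞) (ν p q : Measure Y) : ℝ≥0∞ :=
  ∫⁻ y, φ (dens ν p y) (dens ν q y) ∂ν

/-- Passing from `ν` to `ν'` multiplies both densities by dν/dν', and homogeneity pulls this factor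
out as the density of `ν`. -/
lemma persp_eq_of_ac {φ : ℝ → ℝ → ℝ≥0∞} (hφ : PosHomogeneous φ)
    (hm : Measurable (Function.uncurry φ)) {ν ν' p q : Measure Y}
    [IsFiniteMeasure ν] [IsFiniteMeasure ν'] [IsFiniteMeasure p] [IsFiniteMeasure q]
    (hp : p ≪ ν) (hq : q ≪ ν) (hν : ν ≪ ν') : persp φ ν p q = persp φ ν' p q := by
  unfold persp
  have hm' : Measurable fun y => φ (dens ν p y) (dens ν q y) :=
    hm.comp ((measurable_dens ν p).prodMk (measurable_dens ν q))
  rw [← lintegral_dens_mul hν hm']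
  refine lintegral_congr_ae ?_
  filter_upwards [dens_chain (ν' := ν') hp, dens_chain (ν' := ν') hq] with y h1 h2
  rw [h1, h2, hφ _ _ _ (dens_nonneg _ _ _) (dens_nonneg _ _ _) (dens_nonneg _ _ _)]

lemma persp_add_eq {φ : ℝ → ℝ → ℝ≥0∞} (hφ : PosHomogeneous φ)
    (hm : Measurable (Function.uncurry φ)) {ν p q : Measure Y}
    [IsFiniteMeasure ν] [IsFiniteMeasure p] [IsFiniteMeasure q]
    (hp : p ≪ ν) (hq : q ≪ ν) : persp φ (p + q) p q = persp φ ν p q :=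
  persp_eq_of_ac hφ hm (Measure.AbsolutelyContinuous.rfl.add_right _)
    (add_comm p q ▸ Measure.AbsolutelyContinuous.rfl.add_right _)
    (Measure.AbsolutelyContinuous.add_left hp hq)

/-- A finite measure dominating a countable family. -/
lemma exists_dominating {ι : Type*} [Countable ι] (μ : ι → Measure Y) [∀ i, IsFiniteMeasure (μ i)] :
    ∃ ν : Measure Y, IsFiniteMeasure ν ∧ ∀ i, μ i ≪ ν :=
  ⟨(Measure.sum μ).toFinite, inferInstance, fun i =>
    (Measure.le_sum μ i).absolutelyContinuous.trans (absolutelyContinuous_toFinite _)⟩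

/-! ### The integrands and their comparison with the Hellinger integrand -/

/-- The perspective `b * klFun (a / b)` of the Kullback-Leibler integrand. -/
noncomputable def klPersp (a b : ℝ) : ℝ≥0∞ :=
  if b = 0 then (if a = 0 then 0 else ⊤) else ENNReal.ofReal (b * klFun (a / b))

/-- The integrand of the order `α` affinity. -/
noncomputable def affFun (α a b : ℝ) : ℝ≥0∞ := ENNReal.ofReal (a ^ α * b ^ (1 - α))

/-- The nonnegative convex integrand of which the order `α` divergence is a function. -/
noncomputable def gapFun (α a b : ℝ) : ℝ≥0∞ :=
  if α = 1 then klPersp a b else ENNReal.ofReal (α * a + (1 - α) * b - a ^ α * b ^ (1 - α))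

/-- A constant comparing `gapFun` with the squared Hellinger distance. -/
noncomputable def gapConst (α : ℝ) : ℝ := if α = 1 then 1 else min α (1 - α)

lemma gapConst_pos {α : ℝ} (hα : 0 < α) (hα' : α ≤ 1) : 0 < gapConst α := by
  unfold gapConst
  split_ifs with h
  · exact one_pos
  · exact lt_min hα (sub_pos.2 (lt_of_le_of_ne hα' h))

lemma sqrt_sub_sq_eq {a b : ℝ} (ha : 0 ≤ a) (hb : 0 ≤ b) :
    (√a - √b) ^ 2 = a + b - 2 * (√a * √b) := by
  nlinarith [Real.sq_sqrt ha, Real.sq_sqrt hb]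

/-- Since a^α b^(1-α) = (√a √b)^(2α) b^(1-2α), weighted AM-GM bounds it by 2α √a √b + (1-2α) b,
which is the claim rearranged. -/
lemma mul_sqrt_sub_sq_le_of_le_half {α a b : ℝ} (hα : 0 < α) (hα' : α ≤ 1 / 2) (ha : 0 ≤ a)
    (hb : 0 ≤ b) : α * (√a - √b) ^ 2 ≤ α * a + (1 - α) * b - a ^ α * b ^ (1 - α) := by
  have h := Real.geom_mean_le_arith_mean2_weighted (w₁ := 2 * α) (w₂ := 1 - 2 * α)
    (p₁ := √a * √b) (p₂ := b) (by linarith) (by linarith) (by positivity) hb (by ring)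
  have e : (√a * √b) ^ (2 * α) * b ^ (1 - 2 * α) = a ^ α * b ^ (1 - α) := by
    rw [Real.mul_rpow (by positivity) (by positivity), Real.sqrt_eq_rpow, Real.sqrt_eq_rpow,
      ← Real.rpow_mul ha, ← Real.rpow_mul hb, mul_assoc,
      ← Real.rpow_add_of_nonneg hb (by linarith) (by linarith)]
    congr 2 <;> ring
  rw [e] at h
  rw [sqrt_sub_sq_eq ha hb]
  linarith

/-- The right side is invariant under exchanging (α, a, b) with (1 - α, b, a), which reduces α ≥ 1/2
to the previous case. -/
lemma mul_sqrt_sub_sq_le {α a b : ℝ} (hα : 0 < α) (hα' : α < 1) (ha : 0 ≤ a)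
    (hb : 0 ≤ b) :
    min α (1 - α) * (√a - √b) ^ 2 ≤ α * a + (1 - α) * b - a ^ α * b ^ (1 - α) := by
  rcases le_total α (1 / 2) with h | h
  · refine (mul_le_mul_of_nonneg_right (min_le_left _ _) (sq_nonneg _)).trans ?_
    exact mul_sqrt_sub_sq_le_of_le_half hα h ha hb
  · refine (mul_le_mul_of_nonneg_right (min_le_right _ _) (sq_nonneg _)).trans ?_
    have := mul_sqrt_sub_sq_le_of_le_half (α := 1 - α) (by linarith) (by linarith) hb ha
    rw [sub_sub_cancel] at this
    calc _ = (1 - α) * (√b - √a) ^ 2 := by ring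
      _ ≤ _ := this
      _ = _ := by ring

/-- This is log x ≤ x - 1 at x = √(b/a), multiplied by 2a. -/
lemma sqrt_sub_sq_le_klFun {a b : ℝ} (ha : 0 ≤ a) (hb : 0 < b) :
    (√a - √b) ^ 2 ≤ b * klFun (a / b) := by
  rcases ha.eq_or_lt with rfl | ha
  · simp [klFun_apply, Real.sq_sqrt hb.le]
  have hx : 0 < √b / √a := by positivity
  have h1 := Real.log_le_sub_one_of_pos hx
  have h2 : Real.log (√b / √a) = - (Real.log (a / b) / 2) := by
    rw [Real.log_div (by positivity) (by positivity), Real.log_sqrt hb.le, Real.log_sqrt ha.le,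
      Real.log_div ha.ne' hb.ne']
    ring
  rw [h2] at h1
  have h3 : b * klFun (a / b) = a * Real.log (a / b) + b - a := by
    rw [klFun_apply]; field_simp
  have h4 : a * (√b / √a) = √a * √b := by
    nth_rw 1 [← Real.mul_self_sqrt ha.le]
    field_simp
  rw [sqrt_sub_sq_eq ha.le hb.le, h3]
  nlinarith [mul_le_mul_of_nonneg_left h1 ha.le]

lemma gapConst_mul_le_gapFun {α a b : ℝ} (hα : 0 < α) (hα' : α ≤ 1) (ha : 0 ≤ a) (hb : 0 ≤ b) :
    ENNReal.ofReal (gapConst α * (√a - √b) ^ 2) ≤ gapFun α a b := by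
  unfold gapConst gapFun
  split_ifs with h
  · unfold klPersp
    split_ifs with h1 h2
    · simp [h1, h2]
    · exact le_top
    · rw [one_mul]
      exact ENNReal.ofReal_le_ofReal (sqrt_sub_sq_le_klFun ha (lt_of_le_of_ne hb (Ne.symm h1)))
  · exact ENNReal.ofReal_le_ofReal (mul_sqrt_sub_sq_le hα (lt_of_le_of_ne hα' h) ha hb)

lemma rpow_mul_rpow_smul {α a b c : ℝ} (hα : 0 < α) (hα' : α ≤ 1) (hc : 0 ≤ c) (ha : 0 ≤ a)
    (hb : 0 ≤ b) : (c * a) ^ α * (c * b) ^ (1 - α) = c * (a ^ α * b ^ (1 - α)) := by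
  rw [Real.mul_rpow hc ha, Real.mul_rpow hc hb]
  have : c ^ α * c ^ (1 - α) = c := by
    rw [← Real.rpow_add_of_nonneg hc hα.le (by linarith)]; simp
  calc _ = (c ^ α * c ^ (1 - α)) * (a ^ α * b ^ (1 - α)) := by ring
    _ = _ := by rw [this]

lemma posHomogeneous_affFun {α : ℝ} (hα : 0 < α) (hα' : α ≤ 1) : PosHomogeneous (affFun α) := by
  intro c a b hc ha hb
  rw [affFun, affFun, rpow_mul_rpow_smul hα hα' hc ha hb, ENNReal.ofReal_mul hc]

lemma measurable_affFun (α : ℝ) : Measurable (Function.uncurry (affFun α)) := by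
  unfold affFun Function.uncurry; fun_prop

lemma posHomogeneous_gapFun {α : ℝ} (hα : 0 < α) (hα' : α ≤ 1) : PosHomogeneous (gapFun α) := by
  intro c a b hc ha hb
  by_cases h : α = 1
  · simp only [gapFun, h, if_true]
    rcases hc.eq_or_lt with rfl | hc'
    · simp [klPersp]
    unfold klPersp
    by_cases h1 : b = 0
    · by_cases h2 : a = 0
      · simp [h1, h2]
      · simp [h1, h2, hc'.ne', hc']
    · rw [if_neg (mul_ne_zero hc'.ne' h1), if_neg h1, mul_div_mul_left _ _ hc'.ne', mul_assoc,
        ENNReal.ofReal_mul hc]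
  · simp only [gapFun, h, if_false]
    rw [← ENNReal.ofReal_mul hc, rpow_mul_rpow_smul hα hα' hc ha hb]
    congr 1; ring

lemma measurable_gapFun (α : ℝ) : Measurable (Function.uncurry (gapFun α)) := by
  unfold gapFun klPersp Function.uncurry
  by_cases h : α = 1
  · simp only [h, if_true]
    refine Measurable.ite (measurableSet_eq_fun measurable_snd measurable_const) ?_ ?_
    · exact Measurable.ite (measurableSet_eq_fun measurable_fst measurable_const)
        measurable_const measurable_const
    · fun_prop
  · simp only [h, if_false]
    fun_prop

/-! ### Lower semicontinuity of the integrands -/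

/-- Fenchel–Young: exp s - 1 is the convex conjugate of `klFun`. -/
lemma affine_le_klFun {a b : ℝ} (ha : 0 ≤ a) (hb : 0 < b) (s : ℝ) :
    a * s - b * (Real.exp s - 1) ≤ b * klFun (a / b) := by
  have h3 : b * klFun (a / b) = a * Real.log (a / b) + b - a := by
    rw [klFun_apply]; field_simp
  rw [h3]
  rcases ha.eq_or_lt with rfl | ha
  · have := Real.exp_pos s
    simp; nlinarith
  have h1 := Real.add_one_le_exp (s - Real.log (a / b))
  have h2 : a * Real.exp (s - Real.log (a / b)) = b * Real.exp s := by
    rw [Real.exp_sub, Real.exp_log (by positivity)]; field_simp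
  nlinarith [mul_le_mul_of_nonneg_left h1 ha.le]

lemma affine_le_klPersp {a b : ℝ} (ha : 0 ≤ a) (hb : 0 ≤ b) (s : ℝ) :
    ENNReal.ofReal (a * s - b * (Real.exp s - 1)) ≤ klPersp a b := by
  unfold klPersp
  split_ifs with h1 h2
  · simp [h1, h2]
  · exact le_top
  · exact ENNReal.ofReal_le_ofReal (affine_le_klFun ha (lt_of_le_of_ne hb (Ne.symm h1)) s)

lemma exists_lt_affine {a b : ℝ} (ha : 0 ≤ a) (hb : 0 ≤ b) {x : ℝ≥0∞} (hx : x < klPersp a b) :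
    ∃ s : ℝ, x < ENNReal.ofReal (a * s - b * (Real.exp s - 1)) := by
  unfold klPersp at hx
  split_ifs at hx with h1 h2
  · simp at hx
  · have ha' : 0 < a := lt_of_le_of_ne ha (Ne.symm h2)
    -- With b = 0 the affine function is a * s, unbounded in s; this slope gives the value x + 1.
    refine ⟨(x.toReal + 1) / a, ?_⟩
    rw [h1, zero_mul, sub_zero, mul_div_cancel₀ _ h2]
    exact (ENNReal.lt_ofReal_iff_toReal_lt hx.ne).2 (by linarith)
  · have hb' : 0 < b := lt_of_le_of_ne hb (Ne.symm h1)
    rcases ha.eq_or_lt with rfl | ha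
    · rw [zero_div, klFun_zero, mul_one] at hx
      have hx' := (ENNReal.lt_ofReal_iff_toReal_lt (hx.trans_le le_top).ne).1 hx
      have hp : 0 < (b - x.toReal) / (2 * b) := by
        apply div_pos <;> linarith
      -- With a = 0 the supremum b is approached only as s → -∞; this slope gives the midpoint of x
      -- and b.
      refine ⟨Real.log ((b - x.toReal) / (2 * b)), ?_⟩
      rw [Real.exp_log hp, ENNReal.lt_ofReal_iff_toReal_lt (hx.trans_le le_top).ne]
      have : b * ((b - x.toReal) / (2 * b)) = (b - x.toReal) / 2 := by field_simp
      nlinarith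
    -- The conjugate slope, where Fenchel–Young is an equality.
    · refine ⟨Real.log (a / b), ?_⟩
      convert hx using 2
      rw [Real.exp_log (by positivity), klFun_apply]
      field_simp
      ring

/-- On the closed quadrant, boundary included, `klPersp` is a supremum of positive parts of
continuous functions, hence lower semicontinuous. -/
lemma klPersp_le_liminf {ι : Type*} {l : Filter ι} [l.NeBot] {u v : ι → ℝ} {a b : ℝ}
    (hu : ∀ i, 0 ≤ u i) (hv : ∀ i, 0 ≤ v i) (ha : Tendsto u l (𝓝 a)) (hb : Tendsto v l (𝓝 b)) :
    klPersp a b ≤ liminf (fun i => klPersp (u i) (v i)) l := by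
  have ha0 : 0 ≤ a := ge_of_tendsto' ha hu
  have hb0 : 0 ≤ b := ge_of_tendsto' hb hv
  refine le_of_forall_lt fun x hx => ?_
  obtain ⟨s, hs⟩ := exists_lt_affine ha0 hb0 hx
  refine hs.trans_le ?_
  have ht : Tendsto (fun i => ENNReal.ofReal (u i * s - v i * (Real.exp s - 1))) l
      (𝓝 (ENNReal.ofReal (a * s - b * (Real.exp s - 1)))) :=
    ENNReal.tendsto_ofReal ((ha.mul_const s).sub (hb.mul_const _))
  rw [← ht.liminf_eq]
  exact liminf_le_liminf (Eventually.of_forall fun i => affine_le_klPersp (hu i) (hv i) s)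

lemma gapFun_le_liminf {α : ℝ} (hα : 0 < α) (hα' : α ≤ 1) {ι : Type*} {l : Filter ι} [l.NeBot]
    {u v : ι → ℝ} {a b : ℝ} (hu : ∀ i, 0 ≤ u i) (hv : ∀ i, 0 ≤ v i) (ha : Tendsto u l (𝓝 a))
    (hb : Tendsto v l (𝓝 b)) :
    gapFun α a b ≤ liminf (fun i => gapFun α (u i) (v i)) l := by
  unfold gapFun
  split_ifs with h
  · exact klPersp_le_liminf hu hv ha hb
  · have h1 : 0 < 1 - α := sub_pos.2 (lt_of_le_of_ne hα' h)
    refine le_of_eq (Tendsto.liminf_eq ?_).symm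
    refine ENNReal.tendsto_ofReal (((ha.const_mul α).add (hb.const_mul _)).sub ?_)
    exact (ha.rpow_const (Or.inr hα.le)).mul (hb.rpow_const (Or.inr h1.le))

/-! ### The gap, the affinity and the Rényi divergence -/

/-- The integral of `gapFun`, an `f`-divergence. -/
noncomputable def gap (α : ℝ) (p q : Measure Y) : ℝ≥0∞ := persp (gapFun α) (p + q) p q

/-- The order `α` affinity `∫ p ^ α q ^ (1 - α)`. -/
noncomputable def aff (α : ℝ) (p q : Measure Y) : ℝ≥0∞ := persp (affFun α) (p + q) p q

lemma gap_eq {α : ℝ} (hα : 0 < α) (hα' : α ≤ 1) {ν p q : Measure Y}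
    [IsFiniteMeasure ν] [IsFiniteMeasure p] [IsFiniteMeasure q] (hp : p ≪ ν) (hq : q ≪ ν) :
    gap α p q = persp (gapFun α) ν p q :=
  persp_add_eq (posHomogeneous_gapFun hα hα') (measurable_gapFun α) hp hq

lemma aff_eq {α : ℝ} (hα : 0 < α) (hα' : α ≤ 1) {ν p q : Measure Y}
    [IsFiniteMeasure ν] [IsFiniteMeasure p] [IsFiniteMeasure q] (hp : p ≪ ν) (hq : q ≪ ν) :
    aff α p q = persp (affFun α) ν p q :=
  persp_add_eq (posHomogeneous_affFun hα hα') (measurable_affFun α) hp hq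

lemma ac_add_left (p q : Measure Y) : p ≪ p + q := Measure.AbsolutelyContinuous.rfl.add_right _

lemma ac_add_right (p q : Measure Y) : q ≪ p + q := add_comm q p ▸ ac_add_left q p

/-- The two integrands add up to α a + (1 - α) b, whose integral is 1. Hence the divergence is a
function of the gap. -/
lemma gap_add_aff {α : ℝ} (hα : 0 < α) (hα' : α < 1) (p q : Measure Y)
    [IsProbabilityMeasure p] [IsProbabilityMeasure q] : gap α p q + aff α p q = 1 := by
  unfold gap aff persp
  have hm : Measurable fun y => affFun α (dens (p + q) p y) (dens (p + q) q y) :=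
    (measurable_affFun α).comp ((measurable_dens _ _).prodMk (measurable_dens _ _))
  rw [← lintegral_add_right _ hm]
  have : ∀ y, gapFun α (dens (p + q) p y) (dens (p + q) q y) +
      affFun α (dens (p + q) p y) (dens (p + q) q y) =
      ENNReal.ofReal α * ENNReal.ofReal (dens (p + q) p y) +
        ENNReal.ofReal (1 - α) * ENNReal.ofReal (dens (p + q) q y) := by
    intro y
    have h1 := dens_nonneg (p + q) p y
    have h2 := dens_nonneg (p + q) q y
    have h3 := mul_sqrt_sub_sq_le hα hα' h1 h2
    have h4 : 0 ≤ min α (1 - α) := le_min hα.le (by linarith)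
    rw [gapFun, if_neg hα'.ne, affFun, ← ENNReal.ofReal_add (le_trans (by positivity) h3)
      (by positivity), ← ENNReal.ofReal_mul hα.le, ← ENNReal.ofReal_mul (by linarith),
      ← ENNReal.ofReal_add (by positivity) (mul_nonneg (by linarith) h2)]
    congr 1; ring
  simp_rw [this]
  rw [lintegral_add_left (by fun_prop), lintegral_const_mul _ (by fun_prop),
    lintegral_const_mul _ (by fun_prop), lintegral_dens (ac_add_left p q),
    lintegral_dens (ac_add_right p q), measure_univ, measure_univ, mul_one, mul_one,
    ← ENNReal.ofReal_add hα.le (by linarith)]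
  simp

lemma aff_le_one {α : ℝ} (hα : 0 < α) (hα' : α < 1) (p q : Measure Y)
    [IsProbabilityMeasure p] [IsProbabilityMeasure q] : aff α p q ≤ 1 :=
  gap_add_aff hα hα' p q ▸ le_add_self

lemma aff_eq_one_sub {α : ℝ} (hα : 0 < α) (hα' : α < 1) (p q : Measure Y)
    [IsProbabilityMeasure p] [IsProbabilityMeasure q] : aff α p q = 1 - gap α p q := by
  rw [← gap_add_aff hα hα' p q, ENNReal.add_sub_cancel_left]
  exact ne_top_of_le_ne_top ENNReal.one_ne_top (gap_add_aff hα hα' p q ▸ le_self_add)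

/-- Without absolute continuity both sides are infinite: a finite gap makes the integrand finite
almost everywhere, so the density of `p` vanishes wherever that of `q` does. -/
lemma klDiv_eq_gap (p q : Measure Y) [IsProbabilityMeasure p] [IsProbabilityMeasure q] :
    klDiv p q = gap 1 p q := by
  by_cases h : p ≪ q
  · rw [gap, ← persp_eq_of_ac (posHomogeneous_gapFun one_pos le_rfl) (measurable_gapFun 1) h
      Measure.AbsolutelyContinuous.rfl (ac_add_right p q), klDiv_eq_lintegral_klFun_of_ac h, persp]
    refine lintegral_congr_ae ?_
    filter_upwards [q.rnDeriv_self] with y hy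
    simp [gapFun, klPersp, dens, hy]
  · rw [klDiv_of_not_ac h]
    by_contra hne
    refine h (Measure.AbsolutelyContinuous.mk fun s hs hqs => ?_)
    have h1 := ae_lt_top ((measurable_gapFun 1).comp
      ((measurable_dens (p + q) p).prodMk (measurable_dens (p + q) q))) (Ne.symm hne)
    rw [← withDensity_dens (ac_add_left p q), withDensity_apply _ hs]
    rw [← withDensity_dens (ac_add_right p q), withDensity_apply _ hs,
      lintegral_eq_zero_iff (by fun_prop)] at hqs
    rw [lintegral_eq_zero_iff (by fun_prop)]
    filter_upwards [hqs, ae_restrict_of_ae h1] with y hy1 hy2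
    have hq0 : dens (p + q) q y = 0 :=
      le_antisymm (ENNReal.ofReal_eq_zero.1 hy1) (dens_nonneg _ _ _)
    simp only [Function.comp_apply, Function.uncurry_apply_pair, gapFun, klPersp, hq0,
      if_true] at hy2
    split_ifs at hy2 with h3
    · simp [h3]
    · simp at hy2

lemma renyiDiv_of_lt_one {α : ℝ} (hα : 0 < α) (hα' : α < 1) (w q : ProbabilityMeasure Y) :
    renyiDiv α w q = (((α - 1)⁻¹ : ℝ) : EReal) * ENNReal.log (aff α (w : Measure Y) q) := by
  rw [renyiDiv, if_neg hα'.ne, aff, persp]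
  congr 2
  refine lintegral_congr_ae ?_
  filter_upwards [ofReal_dens_ae_eq ((w : Measure Y) + (q : Measure Y)) w,
    ofReal_dens_ae_eq ((w : Measure Y) + (q : Measure Y)) q] with y h1 h2
  rw [← h1, ← h2, affFun, ENNReal.ofReal_mul (Real.rpow_nonneg (dens_nonneg _ _ _) _),
    ENNReal.ofReal_rpow_of_nonneg (dens_nonneg _ _ _) hα.le,
    ENNReal.ofReal_rpow_of_nonneg (dens_nonneg _ _ _) (by linarith)]

lemma renyiDiv_nonneg {α : ℝ} (hα : 0 < α) (hα' : α ≤ 1) (w q : ProbabilityMeasure Y) :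
    0 ≤ renyiDiv α w q := by
  rcases hα'.eq_or_lt with rfl | hα'
  · rw [renyiDiv, if_pos rfl]
    exact EReal.coe_ennreal_nonneg _
  · rw [renyiDiv_of_lt_one hα hα']
    refine EReal.mul_nonneg_iff.2 (Or.inr ⟨?_, ENNReal.log_le_zero_iff.2 (aff_le_one hα hα' _ _)⟩)
    exact_mod_cast inv_nonpos.2 (by linarith)

/-- The order `α` Rényi divergence as an extended nonnegative real. -/
noncomputable def rd (α : ℝ) (w q : ProbabilityMeasure Y) : ℝ≥0∞ := (renyiDiv α w q).toENNReal

lemma coe_rd {α : ℝ} (hα : 0 < α) (hα' : α ≤ 1) (w q : ProbabilityMeasure Y) :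
    (rd α w q : EReal) = renyiDiv α w q :=
  EReal.coe_toENNReal (renyiDiv_nonneg hα hα' w q)

/-- The function expressing the divergence through the gap. -/
noncomputable def gapToDiv (α : ℝ) (j : ℝ≥0∞) : ℝ≥0∞ :=
  if α = 1 then j else ((((α - 1)⁻¹ : ℝ) : EReal) * ENNReal.log (1 - j)).toENNReal

lemma rd_eq_gapToDiv {α : ℝ} (hα : 0 < α) (hα' : α ≤ 1) (w q : ProbabilityMeasure Y) :
    rd α w q = gapToDiv α (gap α (w : Measure Y) q) := by
  rcases hα'.eq_or_lt with rfl | hα'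
  · simp [rd, renyiDiv, gapToDiv, klDiv_eq_gap]
  · rw [rd, renyiDiv_of_lt_one hα hα', gapToDiv, if_neg hα'.ne, aff_eq_one_sub hα hα']

lemma rd_eq_top {α : ℝ} (hα : 0 < α) (hα' : α < 1) {w q : ProbabilityMeasure Y}
    (h : aff α (w : Measure Y) q = 0) : rd α w q = ⊤ := by
  rw [rd, renyiDiv_of_lt_one hα hα', h, ENNReal.log_zero, EReal.coe_mul_bot_of_neg]
  · rfl
  · exact inv_lt_zero.2 (by linarith)

lemma rd_eq_ofReal {α : ℝ} (hα : 0 < α) (hα' : α < 1) {w q : ProbabilityMeasure Y}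
    (h : aff α (w : Measure Y) q ≠ 0) :
    rd α w q = ENNReal.ofReal ((α - 1)⁻¹ * Real.log (aff α (w : Measure Y) q).toReal) := by
  rw [rd, renyiDiv_of_lt_one hα hα', ENNReal.log_pos_real h
    (ne_top_of_le_ne_top ENNReal.one_ne_top (aff_le_one hα hα' _ _)), ← EReal.coe_mul]
  rfl

lemma monotone_gapToDiv {α : ℝ} (hα' : α ≤ 1) : Monotone (gapToDiv α) := by
  intro i j hij
  unfold gapToDiv
  split_ifs with h
  · exact hij
  · have h1 : (((α - 1)⁻¹ : ℝ) : EReal) ≤ 0 := by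
      exact_mod_cast inv_nonpos.2 (by linarith)
    refine EReal.toENNReal_le_toENNReal ?_
    rw [mul_comm, mul_comm _ (ENNReal.log (1 - j))]
    exact EReal.mul_le_mul_of_nonpos_right (ENNReal.log_le_log (tsub_le_tsub_left hij 1)) h1

/-- Together with monotonicity this lets `gapToDiv` commute with liminf. Multiplication by a nonzero
finite constant is continuous on all of `EReal`, so infinite values cause no trouble. -/
lemma continuous_gapToDiv (α : ℝ) : Continuous (gapToDiv α) := by
  unfold gapToDiv
  split_ifs with h
  · exact continuous_id
  · refine Continuous.ereal_toENNReal ?_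
    have h0 : (α - 1)⁻¹ ≠ 0 := inv_ne_zero (sub_ne_zero.2 h)
    have h1 : Continuous fun x : EReal => (((α - 1)⁻¹ : ℝ) : EReal) * x := by
      refine continuous_iff_continuousAt.2 fun x => ?_
      exact (EReal.continuousAt_mul (p := ((((α - 1)⁻¹ : ℝ) : EReal), x))
        (Or.inl (EReal.coe_ne_zero.2 h0)) (Or.inl (EReal.coe_ne_zero.2 h0))
        (Or.inl (EReal.coe_ne_bot _)) (Or.inl (EReal.coe_ne_top _))).comp
        (continuousAt_const.prodMk continuousAt_id)
    exact h1.comp (ENNReal.continuous_log.comp (ENNReal.continuous_sub_left ENNReal.one_ne_top))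

/-- For α < 1 this is -log x ≥ 1 - x at the affinity x, with 1 / (1 - α) ≥ 1. -/
lemma gap_le_rd {α : ℝ} (hα : 0 < α) (hα' : α ≤ 1) (w q : ProbabilityMeasure Y) :
    gap α (w : Measure Y) q ≤ rd α w q := by
  rcases hα'.eq_or_lt with rfl | hα'
  · simp [rd_eq_gapToDiv, gapToDiv]
  by_cases h : aff α (w : Measure Y) q = 0
  · rw [rd_eq_top hα hα' h]; exact le_top
  have h1 := gap_add_aff hα hα' (w : Measure Y) (q : Measure Y)
  have hg : gap α (w : Measure Y) q ≠ ⊤ :=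
    ne_top_of_le_ne_top ENNReal.one_ne_top (h1 ▸ le_self_add)
  have ha : aff α (w : Measure Y) q ≠ ⊤ :=
    ne_top_of_le_ne_top ENNReal.one_ne_top (aff_le_one hα hα' _ _)
  have h2 : (gap α (w : Measure Y) q).toReal + (aff α (w : Measure Y) q).toReal = 1 := by
    rw [← ENNReal.toReal_add hg ha, h1, ENNReal.toReal_one]
  have h3 : 0 < (aff α (w : Measure Y) q).toReal := ENNReal.toReal_pos h ha
  rw [rd_eq_ofReal hα hα' h, ← ENNReal.ofReal_toReal hg]
  refine ENNReal.ofReal_le_ofReal ?_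
  have h4 := Real.log_le_sub_one_of_pos h3
  have h5 : 1 ≤ (1 - α)⁻¹ := (one_le_inv₀ (by linarith)).2 (by linarith)
  have h6 : (α - 1)⁻¹ = - (1 - α)⁻¹ := by rw [← inv_neg, neg_sub]
  rw [h6]
  have h7 : 0 ≤ (gap α (w : Measure Y) q).toReal := ENNReal.toReal_nonneg
  nlinarith

/-! ### Hellinger distance: completeness and lower semicontinuity of the divergence -/

/-- The Hellinger distance integrand. -/
noncomputable def hellFun (a b : ℝ) : ℝ≥0∞ := ENNReal.ofReal ((√a - √b) ^ 2)

lemma posHomogeneous_hellFun : PosHomogeneous hellFun := by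
  intro c a b hc ha hb
  rw [hellFun, hellFun, ← ENNReal.ofReal_mul hc, Real.sqrt_mul hc, Real.sqrt_mul hc, ← mul_sub,
    mul_pow, Real.sq_sqrt hc]

lemma measurable_hellFun : Measurable (Function.uncurry hellFun) := by
  unfold hellFun Function.uncurry; fun_prop

/-- The Hellinger distance of two measures. -/
noncomputable def hell (p q : Measure Y) : ℝ≥0∞ := (persp hellFun (p + q) p q) ^ (1 / 2 : ℝ)

lemma eLpNorm_two_eq (f : Y → ℝ) (ν : Measure Y) :
    eLpNorm f 2 ν = (∫⁻ y, ENNReal.ofReal (f y ^ 2) ∂ν) ^ (1 / 2 : ℝ) := by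
  rw [eLpNorm_eq_lintegral_rpow_enorm_toReal (by norm_num) (by norm_num)]
  congr 1
  refine lintegral_congr fun y => ?_
  rw [← sq_abs, ENNReal.ofReal_pow (abs_nonneg _), Real.enorm_eq_ofReal_abs]
  simp

lemma hell_eq {ν p q : Measure Y} [IsFiniteMeasure ν] [IsFiniteMeasure p] [IsFiniteMeasure q]
    (hp : p ≪ ν) (hq : q ≪ ν) :
    hell p q = eLpNorm ((fun y => √(dens ν p y)) - fun y => √(dens ν q y)) 2 ν := by
  rw [hell, persp_add_eq posHomogeneous_hellFun measurable_hellFun hp hq, eLpNorm_two_eq]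
  rfl

lemma hell_sq (p q : Measure Y) : hell p q ^ 2 = persp hellFun (p + q) p q := by
  rw [hell, ← ENNReal.rpow_natCast, ← ENNReal.rpow_mul]; norm_num

lemma measurable_sqrt_dens (ν p : Measure Y) : Measurable fun y => √(dens ν p y) :=
  (measurable_dens ν p).sqrt

/-- Under a common dominating measure this is Minkowski's inequality in L² for the square roots of
the densities. -/
lemma hell_triangle_right (p q r : Measure Y) [IsFiniteMeasure p] [IsFiniteMeasure q]
    [IsFiniteMeasure r] : hell p q ≤ hell p r + hell q r := by
  have hp : p ≪ p + q + r := (ac_add_left p q).trans (ac_add_left _ _)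
  have hq : q ≪ p + q + r := (ac_add_right p q).trans (ac_add_left _ _)
  have hr : r ≪ p + q + r := ac_add_right _ _
  rw [hell_eq hp hq, hell_eq hp hr, hell_eq hq hr,
    eLpNorm_sub_comm (fun y => √(dens _ q y)) (fun y => √(dens _ r y))]
  refine le_trans (le_of_eq ?_) (eLpNorm_add_le ?_ ?_ (by norm_num))
  · congr 1; abel
  · exact ((measurable_sqrt_dens _ _).sub (measurable_sqrt_dens _ _)).aestronglyMeasurable
  · exact ((measurable_sqrt_dens _ _).sub (measurable_sqrt_dens _ _)).aestronglyMeasurable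

lemma gapConst_mul_hell_sq_le_rd {α : ℝ} (hα : 0 < α) (hα' : α ≤ 1) (p q : ProbabilityMeasure Y) :
    ENNReal.ofReal (gapConst α) * hell (p : Measure Y) q ^ 2 ≤ rd α p q := by
  refine le_trans ?_ (gap_le_rd hα hα' p q)
  rw [hell_sq, persp, gap, persp, ← lintegral_const_mul]
  · refine lintegral_mono fun y => ?_
    dsimp only
    rw [hellFun, ← ENNReal.ofReal_mul (gapConst_pos hα hα').le]
    exact gapConst_mul_le_gapFun hα hα' (dens_nonneg _ _ _) (dens_nonneg _ _ _)
  · exact measurable_hellFun.comp ((measurable_dens _ _).prodMk (measurable_dens _ _))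

lemma hell_le_of_rd_le {α : ℝ} (hα : 0 < α) (hα' : α ≤ 1) {p q : ProbabilityMeasure Y} {b : ℝ≥0∞}
    (h : rd α p q ≤ ENNReal.ofReal (gapConst α) * b ^ 2) : hell (p : Measure Y) q ≤ b := by
  have h1 := (gapConst_mul_hell_sq_le_rd hα hα' p q).trans h
  rw [ENNReal.mul_le_mul_iff_right (ENNReal.ofReal_pos.2 (gapConst_pos hα hα')).ne'
    ENNReal.ofReal_ne_top] at h1
  exact (ENNReal.pow_le_pow_left_iff two_ne_zero).1 h1

lemma eq_of_rd_eq_zero {α : ℝ} (hα : 0 < α) (hα' : α ≤ 1) {p q : ProbabilityMeasure Y}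
    (h : rd α p q = 0) : p = q := by
  have h1 : hell (p : Measure Y) q = 0 :=
    le_antisymm (hell_le_of_rd_le hα hα' (by simp [h])) zero_le
  have hp := ac_add_left (p : Measure Y) (q : Measure Y)
  have hq := ac_add_right (p : Measure Y) (q : Measure Y)
  rw [hell_eq hp hq, eLpNorm_eq_zero_iff ((measurable_sqrt_dens _ (p : Measure Y)).sub
    (measurable_sqrt_dens _ (q : Measure Y))).aestronglyMeasurable two_ne_zero] at h1
  refine ProbabilityMeasure.toMeasure_injective ?_
  refine (withDensity_dens hp).symm.trans ((withDensity_congr_ae ?_).trans (withDensity_dens hq))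
  filter_upwards [h1] with y hy
  rw [Pi.sub_apply, Pi.zero_apply, sub_eq_zero,
    Real.sqrt_inj (dens_nonneg _ _ _) (dens_nonneg _ _ _)] at hy
  rw [hy]

lemma eLpNorm_sqrt_dens {ν p : Measure Y} [IsFiniteMeasure ν] [IsProbabilityMeasure p]
    (h : p ≪ ν) : eLpNorm (fun y => √(dens ν p y)) 2 ν = 1 := by
  rw [eLpNorm_two_eq]
  simp_rw [Real.sq_sqrt (dens_nonneg ν p _)]
  rw [lintegral_dens h, measure_univ, ENNReal.one_rpow]

/-- The Hellinger distance is complete on probability measures. -/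
lemma exists_tendsto_hell (q : ℕ → ProbabilityMeasure Y) (B : ℕ → ℝ≥0∞) (hB : ∑' i, B i ≠ ∞)
    (hq : ∀ N n m : ℕ, N ≤ n → N ≤ m → hell (q n : Measure Y) (q m) < B N) :
    ∃ q' : ProbabilityMeasure Y, Tendsto (fun n => hell (q n : Measure Y) q') atTop (𝓝 0) := by
  obtain ⟨ν, hν, hac⟩ := exists_dominating fun n => (q n : Measure Y)
  set f : ℕ → Y → ℝ := fun n y => √(dens ν (q n) y) with hf
  have hfm : ∀ n, Measurable (f n) := fun n => measurable_sqrt_dens _ _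
  have hf1 : ∀ n, eLpNorm (f n) 2 ν = 1 := fun n => eLpNorm_sqrt_dens (hac n)
  have hfL : ∀ n, MemLp (f n) 2 ν := fun n =>
    ⟨(hfm n).aestronglyMeasurable, by rw [hf1]; exact ENNReal.one_lt_top⟩
  obtain ⟨g, hgL, hg⟩ := Lp.cauchy_complete_eLpNorm (by norm_num) hfL hB fun N n m hn hm => by
    rw [← hell_eq (hac n) (hac m)]; exact hq N n m hn hm
  -- The limit is taken nonnegative and genuinely measurable, so that h² is a density with square
  -- root h. The absolute value does not increase the distance to f n ≥ 0.
  set h : Y → ℝ := fun y => |hgL.1.mk g y| with hh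
  have hhm : Measurable h := hgL.1.stronglyMeasurable_mk.measurable.abs
  have hfh : ∀ n, eLpNorm (f n - h) 2 ν ≤ eLpNorm (f n - g) 2 ν := by
    intro n
    refine eLpNorm_mono_ae ?_
    filter_upwards [hgL.1.ae_eq_mk] with y hy
    rw [Pi.sub_apply, Pi.sub_apply, hh, hy, Real.norm_eq_abs, Real.norm_eq_abs]
    have := abs_abs_sub_abs_le_abs_sub (f n y) (hgL.1.mk g y)
    rwa [abs_of_nonneg (Real.sqrt_nonneg _ : 0 ≤ f n y)] at this
  have hlim : Tendsto (fun n => eLpNorm (f n - h) 2 ν) atTop (𝓝 0) :=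
    tendsto_of_tendsto_of_tendsto_of_le_of_le tendsto_const_nhds hg (fun _ => zero_le) hfh
  have hh1 : eLpNorm h 2 ν = 1 := by
    have hsm : ∀ n, AEStronglyMeasurable (f n - h) ν := fun n =>
      ((hfm n).sub hhm).aestronglyMeasurable
    refine le_antisymm ?_ ?_
    · have : Tendsto (fun n => eLpNorm (f n - h) 2 ν + 1) atTop (𝓝 (0 + 1)) :=
        hlim.add tendsto_const_nhds
      rw [zero_add] at this
      refine ge_of_tendsto' this fun n => ?_
      rw [← hf1 n, add_comm]
      have e : h = f n - (f n - h) := by abel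
      nth_rw 1 [e]
      exact eLpNorm_sub_le (hfm n).aestronglyMeasurable (hsm n) (by norm_num)
    · have : Tendsto (fun n => eLpNorm (f n - h) 2 ν + eLpNorm h 2 ν) atTop
          (𝓝 (0 + eLpNorm h 2 ν)) := hlim.add tendsto_const_nhds
      rw [zero_add] at this
      refine ge_of_tendsto' this fun n => ?_
      rw [← hf1 n]
      have e : f n = (f n - h) + h := by abel
      nth_rw 1 [e]
      exact eLpNorm_add_le (hsm n) hhm.aestronglyMeasurable (by norm_num)
  have hmass : ∫⁻ y, ENNReal.ofReal (h y ^ 2) ∂ν = 1 := by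
    rw [eLpNorm_two_eq] at hh1
    rw [← ENNReal.rpow_one (∫⁻ y, ENNReal.ofReal (h y ^ 2) ∂ν),
      show (1 : ℝ) = 1 / 2 * 2 by norm_num, ENNReal.rpow_mul, hh1, ENNReal.one_rpow]
  have hprob : IsProbabilityMeasure (ν.withDensity fun y => ENNReal.ofReal (h y ^ 2)) :=
    ⟨by rw [withDensity_apply _ MeasurableSet.univ, Measure.restrict_univ, hmass]⟩
  refine ⟨⟨_, hprob⟩, ?_⟩
  refine hlim.congr fun n => ?_
  rw [ProbabilityMeasure.coe_mk, hell_eq (hac n) (withDensity_absolutelyContinuous _ _)]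
  refine eLpNorm_congr_ae ?_
  filter_upwards [dens_withDensity ν (hhm.pow_const 2) fun y => sq_nonneg (h y)] with y hy
  rw [Pi.sub_apply, Pi.sub_apply, hy, Real.sqrt_sq (abs_nonneg _)]

/-- Along a subsequence of a Hellinger convergent sequence, the divergence is lower semicontinuous
in both arguments. -/
lemma exists_subseq_le_liminf {α : ℝ} (hα : 0 < α) (hα' : α ≤ 1) {q : ℕ → ProbabilityMeasure Y}
    {q' : ProbabilityMeasure Y} (hq : Tendsto (fun n => hell (q n : Measure Y) q') atTop (𝓝 0))
    (μ : Measure Y) [IsFiniteMeasure μ] :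
    ∃ k : ℕ → ℕ, StrictMono k ∧ ∀ w : ProbabilityMeasure Y, (w : Measure Y) ≪ μ →
      rd α w q' ≤ liminf (fun n => rd α w (q (k n))) atTop ∧
      rd α q' w ≤ liminf (fun n => rd α (q (k n)) w) atTop := by
  obtain ⟨ν₀, hν₀, hac₀⟩ := exists_dominating fun n => (q n : Measure Y)
  -- Including `μ` here makes one subsequence serve every w ≪ μ, hence all the W(x) in a finite
  -- support at once.
  set ν : Measure Y := ν₀ + ((q' : Measure Y) + μ) with hν
  have hac : ∀ n, (q n : Measure Y) ≪ ν := fun n => (hac₀ n).trans (ac_add_left _ _)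
  have hq' : (q' : Measure Y) ≪ ν := (ac_add_left _ _).trans (ac_add_right _ _)
  have hμ : μ ≪ ν := (ac_add_right _ _).trans (ac_add_right _ _)
  have hm := tendstoInMeasure_of_tendsto_eLpNorm (p := 2) (by norm_num)
    (fun n => (measurable_sqrt_dens ν (q n)).aestronglyMeasurable)
    (measurable_sqrt_dens ν q').aestronglyMeasurable
    (hq.congr fun n => hell_eq (hac n) hq')
  obtain ⟨k, hk, hae⟩ := hm.exists_seq_tendsto_ae
  have hae' : ∀ᵐ y ∂ν, Tendsto (fun n => dens ν (q (k n)) y) atTop (𝓝 (dens ν q' y)) := by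
    filter_upwards [hae] with y hy
    have := hy.pow 2
    simpa only [Real.sq_sqrt (dens_nonneg _ _ _)] using this
  refine ⟨k, hk, fun w hw => ?_⟩
  have hw' := hw.trans hμ
  constructor
  · simp_rw [rd_eq_gapToDiv hα hα']
    rw [show (fun n => gapToDiv α (gap α (w : Measure Y) (q (k n)))) =
      gapToDiv α ∘ fun n => gap α (w : Measure Y) (q (k n)) from rfl,
      ← (monotone_gapToDiv hα').map_liminf_of_continuousAt _ (continuous_gapToDiv α).continuousAt]
    refine monotone_gapToDiv hα' ?_
    simp_rw [gap_eq hα hα' hw' hq', gap_eq hα hα' hw' (hac _)]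
    refine le_trans (lintegral_mono_ae ?_) (lintegral_liminf_le fun n =>
      (measurable_gapFun α).comp ((measurable_dens _ _).prodMk (measurable_dens _ _)))
    filter_upwards [hae'] with y hy
    exact gapFun_le_liminf hα hα' (fun _ => dens_nonneg _ _ _) (fun _ => dens_nonneg _ _ _)
      tendsto_const_nhds hy
  · simp_rw [rd_eq_gapToDiv hα hα']
    rw [show (fun n => gapToDiv α (gap α (q (k n) : Measure Y) w)) =
      gapToDiv α ∘ fun n => gap α (q (k n) : Measure Y) w from rfl,
      ← (monotone_gapToDiv hα').map_liminf_of_continuousAt _ (continuous_gapToDiv α).continuousAt]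
    refine monotone_gapToDiv hα' ?_
    simp_rw [gap_eq hα hα' hq' hw', gap_eq hα hα' (hac _) hw']
    refine le_trans (lintegral_mono_ae ?_) (lintegral_liminf_le fun n =>
      (measurable_gapFun α).comp ((measurable_dens _ _).prodMk (measurable_dens _ _)))
    filter_upwards [hae'] with y hy
    exact gapFun_le_liminf hα hα' (fun _ => dens_nonneg _ _ _) (fun _ => dens_nonneg _ _ _)
      hy tendsto_const_nhds

/-! ### The mean of a finite family at order one -/

lemma dens_sum_smul {ι : Type*} (ν : Measure Y) [IsFiniteMeasure ν] (V : ι → ProbabilityMeasure Y)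
    {p : ι → ℝ} (hp : ∀ i, 0 ≤ p i) (s : Finset ι) :
    ∀ᵐ y ∂ν, dens ν (∑ i ∈ s, ENNReal.ofReal (p i) • (V i : Measure Y)) y =
      ∑ i ∈ s, p i * dens ν (V i) y := by
  classical
  have hf : ∀ s : Finset ι,
      IsFiniteMeasure (∑ i ∈ s, ENNReal.ofReal (p i) • (V i : Measure Y)) := by
    intro s
    refine ⟨?_⟩
    simp only [Measure.coe_finsetSum, Measure.coe_smul, Finset.sum_apply, Pi.smul_apply,
      measure_univ, smul_eq_mul, mul_one]
    exact ENNReal.sum_lt_top.2 fun i _ => ENNReal.ofReal_lt_top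
  induction s using Finset.induction_on with
  | empty =>
    filter_upwards [Measure.rnDeriv_zero ν] with y hy
    simp [dens, hy]
  | insert a s ha ih =>
    have := hf s
    filter_upwards [ih, dens_add_smul ν (V a) (∑ i ∈ s, ENNReal.ofReal (p i) • (V i : Measure Y))
      (hp a) zero_le_one] with y h1 h2
    rw [Finset.sum_insert ha, Finset.sum_insert ha, ← h1]
    simpa using h2

lemma mul_klFun_div {a b : ℝ} (hb : 0 < b) :
    b * klFun (a / b) = a * Real.log a - a * Real.log b + b - a := by
  by_cases ha : a = 0
  · simp [ha, klFun_apply]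
  · rw [klFun_apply, Real.log_div ha hb.ne']
    field_simp

/-- The pointwise compensation inequality for the Kullback-Leibler integrand. -/
lemma sum_klPersp_add_le {ι : Type*} [Fintype ι] {p w : ι → ℝ} (hp : ∀ i, 0 < p i)
    (hs : ∑ i, p i = 1) (hw : ∀ i, 0 ≤ w i) {b : ℝ} (hb : 0 ≤ b) :
    ∑ i, ENNReal.ofReal (p i) * klPersp (w i) (∑ j, p j * w j) + klPersp (∑ j, p j * w j) b ≤
      ∑ i, ENNReal.ofReal (p i) * klPersp (w i) b := by
  set m := ∑ j, p j * w j with hm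
  have hm0 : 0 ≤ m := Finset.sum_nonneg fun i _ => mul_nonneg (hp i).le (hw i)
  rcases hm0.eq_or_lt with h0 | hmpos
  · have hw0 : ∀ i, w i = 0 := by
      intro i
      have := (Finset.sum_eq_zero_iff_of_nonneg fun i _ => mul_nonneg (hp i).le (hw i)).1
        (hm.symm.trans h0.symm) i (Finset.mem_univ i)
      exact (mul_eq_zero.1 this).resolve_left (hp i).ne'
    rw [← h0]
    simp only [hw0]
    rw [← Finset.sum_mul, ← Finset.sum_mul, ← ENNReal.ofReal_sum_of_nonneg fun i _ => (hp i).le, hs]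
    simp [klPersp]
  rcases hb.eq_or_lt with rfl | hb
  · obtain ⟨i, -, hi⟩ : ∃ i ∈ Finset.univ, p i * w i ≠ 0 := by
      by_contra hcon
      push Not at hcon
      exact hmpos.ne' (Finset.sum_eq_zero hcon)
    have hi' : w i ≠ 0 := right_ne_zero_of_mul hi
    have : ∑ i, ENNReal.ofReal (p i) * klPersp (w i) 0 = ⊤ := by
      refine ENNReal.sum_eq_top.2 ⟨i, Finset.mem_univ i, ?_⟩
      simp [klPersp, hi', hp i]
    rw [this]; exact le_top
  · have h1 : ∀ c : ℝ, 0 < c → ∑ i, ENNReal.ofReal (p i) * klPersp (w i) c =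
        ENNReal.ofReal (∑ i, p i * (c * klFun (w i / c))) := by
      intro c hc
      rw [ENNReal.ofReal_sum_of_nonneg fun i _ => mul_nonneg (hp i).le
        (mul_nonneg hc.le (klFun_nonneg (div_nonneg (hw i) hc.le)))]
      refine Finset.sum_congr rfl fun i _ => ?_
      rw [klPersp, if_neg hc.ne', ENNReal.ofReal_mul (hp i).le]
    have h2 : ∀ c : ℝ, 0 < c → ∑ i, p i * (c * klFun (w i / c)) =
        ∑ i, p i * (w i * Real.log (w i)) - m * Real.log c + c - m := by
      intro c hc
      simp_rw [mul_klFun_div hc]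
      have : ∀ i, p i * (w i * Real.log (w i) - w i * Real.log c + c - w i) =
          p i * (w i * Real.log (w i)) - p i * w i * Real.log c + p i * c - p i * w i := by
        intro i; ring
      simp_rw [this]
      rw [Finset.sum_sub_distrib, Finset.sum_add_distrib, Finset.sum_sub_distrib,
        ← Finset.sum_mul, ← Finset.sum_mul, hs, one_mul]
    rw [h1 m hmpos, h1 b hb, klPersp, if_neg hb.ne', ← ENNReal.ofReal_add]
    -- When m and b are both positive the compensation relation is an equality; the terms in w log w
    -- cancel.
    · refine ENNReal.ofReal_le_ofReal (le_of_eq ?_)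
      rw [h2 m hmpos, h2 b hb, mul_klFun_div hb]; ring
    · exact Finset.sum_nonneg fun i _ => mul_nonneg (hp i).le
        (mul_nonneg hmpos.le (klFun_nonneg (div_nonneg (hw i) hmpos.le)))
    · exact mul_nonneg hb.le (klFun_nonneg (div_nonneg hmpos.le hb.le))

/-- The compensation inequality for the Kullback-Leibler divergence. -/
lemma exists_mean_of_eq_one {ι : Type*} [Fintype ι] (V : ι → ProbabilityMeasure Y) {p : ι → ℝ}
    (hp : ∀ i, 0 < p i) (hs : ∑ i, p i = 1) :
    ∃ q : ProbabilityMeasure Y, ∀ Q : ProbabilityMeasure Y,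
      ∑ i, ENNReal.ofReal (p i) * rd 1 (V i) q + rd 1 q Q ≤
        ∑ i, ENNReal.ofReal (p i) * rd 1 (V i) Q := by
  have hprob : IsProbabilityMeasure (∑ i, ENNReal.ofReal (p i) • (V i : Measure Y)) := by
    refine ⟨?_⟩
    simp only [Measure.coe_finsetSum, Measure.coe_smul, Finset.sum_apply, Pi.smul_apply,
      measure_univ, smul_eq_mul, mul_one]
    rw [← ENNReal.ofReal_sum_of_nonneg fun i _ => (hp i).le, hs, ENNReal.ofReal_one]
  refine ⟨⟨_, hprob⟩, fun Q => ?_⟩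
  set q : ProbabilityMeasure Y := ⟨_, hprob⟩ with hq
  set ν : Measure Y := (q : Measure Y) + Q with hν
  have hqν : (q : Measure Y) ≪ ν := ac_add_left _ _
  have hQν : (Q : Measure Y) ≪ ν := ac_add_right _ _
  have hVq : ∀ i, (V i : Measure Y) ≪ q := by
    intro i
    refine Measure.AbsolutelyContinuous.mk fun s _ h => ?_
    rw [hq, ProbabilityMeasure.coe_mk, Measure.coe_finsetSum, Finset.sum_apply,
      Finset.sum_eq_zero_iff] at h
    have := h i (Finset.mem_univ i)
    simpa [(hp i).not_ge] using this
  have hVν : ∀ i, (V i : Measure Y) ≪ ν := fun i => (hVq i).trans hqν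
  have hm : ∀ a b : Measure Y, Measurable fun y => gapFun 1 (dens ν a y) (dens ν b y) :=
    fun a b => (measurable_gapFun 1).comp ((measurable_dens _ _).prodMk (measurable_dens _ _))
  have hsum : ∀ r : ProbabilityMeasure Y, (r : Measure Y) ≪ ν →
      ∑ i, ENNReal.ofReal (p i) * rd 1 (V i) r =
        ∫⁻ y, ∑ i, ENNReal.ofReal (p i) * gapFun 1 (dens ν (V i) y) (dens ν r y) ∂ν := by
    intro r hr
    rw [lintegral_finsetSum _ fun i _ => (hm _ _).const_mul _]
    refine Finset.sum_congr rfl fun i _ => ?_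
    rw [lintegral_const_mul _ (hm _ _), rd_eq_gapToDiv one_pos le_rfl,
      gap_eq one_pos le_rfl (hVν i) hr]
    simp [gapToDiv, persp]
  have hrd : rd 1 q Q = ∫⁻ y, gapFun 1 (dens ν q y) (dens ν Q y) ∂ν := by
    rw [rd_eq_gapToDiv one_pos le_rfl, gap_eq one_pos le_rfl hqν hQν]
    simp [gapToDiv, persp]
  rw [hsum q hqν, hsum Q hQν, hrd, ← lintegral_add_right _ (hm _ _)]
  refine lintegral_mono_ae ?_
  filter_upwards [dens_sum_smul ν V (fun i => (hp i).le) Finset.univ] with y hy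
  have hy' : dens ν q y = ∑ i, p i * dens ν (V i) y := hy
  simp only [gapFun, if_true, hy']
  exact sum_klPersp_add_le hp hs (fun i => dens_nonneg _ _ _) (dens_nonneg _ _ _)

/-! ### The mean of a finite family at orders below one -/

lemma aff_self {α : ℝ} (hα : 0 < α) (hα' : α ≤ 1) (q : Measure Y) [IsProbabilityMeasure q] :
    aff α q q = 1 := by
  rw [aff_eq hα hα' (ν := q) Measure.AbsolutelyContinuous.rfl Measure.AbsolutelyContinuous.rfl,
    persp]
  have : ∫⁻ y, affFun α (dens q q y) (dens q q y) ∂q = ∫⁻ _, 1 ∂q := by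
    refine lintegral_congr_ae ?_
    filter_upwards [q.rnDeriv_self] with y hy
    simp [affFun, dens, hy]
  rw [this]; simp

lemma exists_mixture (q r : ProbabilityMeasure Y) {l : ℝ} (h0 : 0 ≤ l) (h1 : l ≤ 1) :
    ∃ m : ProbabilityMeasure Y,
      (m : Measure Y) = ENNReal.ofReal (1 - l) • (q : Measure Y) + ENNReal.ofReal l • (r : Measure Y) := by
  refine ⟨⟨_, ⟨?_⟩⟩, rfl⟩
  simp only [Measure.coe_add, Measure.coe_smul, Pi.add_apply, Pi.smul_apply, measure_univ,
    smul_eq_mul, mul_one]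
  rw [← ENNReal.ofReal_add (by linarith) h0]; simp

/-- Pointwise concavity of x ↦ x^(1-α), integrated. -/
lemma aff_mixture {α : ℝ} (hα : 0 < α) (hα' : α < 1) (w q r m : ProbabilityMeasure Y) {l : ℝ}
    (h0 : 0 ≤ l) (h1 : l ≤ 1) (hm : (m : Measure Y) =
      ENNReal.ofReal (1 - l) • (q : Measure Y) + ENNReal.ofReal l • (r : Measure Y)) :
    (1 - l) * (aff α (w : Measure Y) q).toReal + l * (aff α (w : Measure Y) r).toReal ≤
      (aff α (w : Measure Y) m).toReal := by
  have hl : 0 ≤ 1 - l := by linarith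
  have hfin : ∀ s : ProbabilityMeasure Y, aff α (w : Measure Y) s ≠ ⊤ := fun s =>
    ne_top_of_le_ne_top ENNReal.one_ne_top (aff_le_one hα hα' _ _)
  set ν : Measure Y := (w : Measure Y) + ((q : Measure Y) + r) with hν
  have hw : (w : Measure Y) ≪ ν := ac_add_left _ _
  have hq : (q : Measure Y) ≪ ν := (ac_add_left _ _).trans (ac_add_right _ _)
  have hr : (r : Measure Y) ≪ ν := (ac_add_right _ _).trans (ac_add_right _ _)
  have hmν : (m : Measure Y) ≪ ν := by
    rw [hm]
    exact Measure.AbsolutelyContinuous.add_left (hq.smul_left _) (hr.smul_left _)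
  have hmeas : ∀ a b : Measure Y, Measurable fun y => affFun α (dens ν a y) (dens ν b y) :=
    fun a b => (measurable_affFun α).comp ((measurable_dens _ _).prodMk (measurable_dens _ _))
  have key : ENNReal.ofReal (1 - l) * aff α (w : Measure Y) q +
      ENNReal.ofReal l * aff α (w : Measure Y) r ≤ aff α (w : Measure Y) m := by
    rw [aff_eq hα hα'.le hw hq, aff_eq hα hα'.le hw hr, aff_eq hα hα'.le hw hmν, persp, persp,
      persp, ← lintegral_const_mul _ (hmeas _ _), ← lintegral_const_mul _ (hmeas _ _),
      ← lintegral_add_left ((hmeas _ _).const_mul _)]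
    refine lintegral_mono_ae ?_
    filter_upwards [dens_add_smul ν q r hl h0] with y hy
    rw [hm, hy]
    have ha := dens_nonneg ν w y
    have hb := dens_nonneg ν q y
    have hc := dens_nonneg ν r y
    unfold affFun
    rw [← ENNReal.ofReal_mul hl, ← ENNReal.ofReal_mul h0, ← ENNReal.ofReal_add
      (mul_nonneg hl (mul_nonneg (Real.rpow_nonneg ha _) (Real.rpow_nonneg hb _)))
      (mul_nonneg h0 (mul_nonneg (Real.rpow_nonneg ha _) (Real.rpow_nonneg hc _)))]
    refine ENNReal.ofReal_le_ofReal ?_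
    have := (Real.concaveOn_rpow (p := 1 - α) (by linarith) (by linarith)).2
      (Set.mem_Ici.2 hb) (Set.mem_Ici.2 hc) hl h0 (by ring)
    simp only [smul_eq_mul] at this
    have h3 := mul_le_mul_of_nonneg_left this (Real.rpow_nonneg ha α)
    linarith
  have := ENNReal.toReal_mono (hfin m) key
  rwa [ENNReal.toReal_add (ENNReal.mul_ne_top ENNReal.ofReal_ne_top (hfin _))
    (ENNReal.mul_ne_top ENNReal.ofReal_ne_top (hfin _)), ENNReal.toReal_mul, ENNReal.toReal_mul,
    ENNReal.toReal_ofReal hl, ENNReal.toReal_ofReal h0] at this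

/-- The first order condition for maximising a weighted geometric mean. -/
lemma sum_mul_le_one_of_prod_le {ι : Type*} [Fintype ι] {p r : ι → ℝ} (hp : ∀ i, 0 < p i)
    (hs : ∑ i, p i = 1) (hr : ∀ i, 0 ≤ r i)
    (h : ∀ l ∈ Set.Ioo (0 : ℝ) 1, ∏ i, ((1 - l) + l * r i) ^ p i ≤ 1) :
    ∑ i, p i * r i ≤ 1 := by
  have h1 : ∀ l ∈ Set.Ioo (0 : ℝ) 1, ∑ i, p i * ((r i - 1) / ((1 - l) + l * r i)) ≤ 0 := by
    intro l hl
    have hpos : ∀ i, 0 < (1 - l) + l * r i := fun i => by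
      have := mul_nonneg hl.1.le (hr i)
      linarith [hl.2]
    have h2 := Real.log_nonpos (Finset.prod_nonneg fun i _ => Real.rpow_nonneg (hpos i).le _)
      (h l hl)
    rw [Real.log_prod fun i _ => (Real.rpow_pos_of_pos (hpos i) _).ne'] at h2
    have h3 : ∑ i, p i * (l * ((r i - 1) / ((1 - l) + l * r i))) ≤ 0 := by
      refine le_trans (Finset.sum_le_sum fun i _ => ?_) h2
      rw [Real.log_rpow (hpos i)]
      refine mul_le_mul_of_nonneg_left ?_ (hp i).le
      -- The bound log x ≥ 1 - 1/x has a factor l on its left side; dividing by l and letting l → 0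
      -- replaces differentiation.
      have h4 := Real.one_sub_inv_le_log_of_pos (hpos i)
      refine le_trans (le_of_eq ?_) h4
      have := (hpos i).ne'
      field_simp; ring
    have h5 : ∑ i, p i * (l * ((r i - 1) / ((1 - l) + l * r i))) =
        l * ∑ i, p i * ((r i - 1) / ((1 - l) + l * r i)) := by
      rw [Finset.mul_sum]; exact Finset.sum_congr rfl fun i _ => by ring
    rw [h5] at h3
    exact nonpos_of_mul_nonpos_right h3 hl.1
  have hc : Tendsto (fun l : ℝ => ∑ i, p i * ((r i - 1) / ((1 - l) + l * r i))) (𝓝[>] 0)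
      (𝓝 (∑ i, p i * ((r i - 1) / ((1 - 0) + 0 * r i)))) := by
    refine tendsto_finsetSum _ fun i _ => ?_
    have : ContinuousAt (fun l : ℝ => p i * ((r i - 1) / ((1 - l) + l * r i))) 0 := by
      refine continuousAt_const.mul (continuousAt_const.div (by fun_prop) (by simp))
    exact this.tendsto.mono_left nhdsWithin_le_nhds
  have h6 := le_of_tendsto hc (by
    filter_upwards [Ioo_mem_nhdsGT one_pos] with l hl using h1 l hl)
  simp only [sub_zero, zero_mul, add_zero, div_one, mul_sub, mul_one, Finset.sum_sub_distrib,
    hs] at h6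
  linarith

lemma withDensity_chain {ν ν' : Measure Y} [IsFiniteMeasure ν] [IsFiniteMeasure ν'] (h : ν ≪ ν')
    {f : Y → ℝ} (hf : Measurable f) :
    ν.withDensity (fun y => ENNReal.ofReal (f y)) =
      ν'.withDensity (fun y => ENNReal.ofReal (dens ν' ν y * f y)) := by
  conv_lhs => rw [← withDensity_dens h]
  rw [← withDensity_mul _ (by fun_prop) (by fun_prop)]
  congr 1
  ext y
  rw [Pi.mul_apply, ENNReal.ofReal_mul (dens_nonneg _ _ _)]

lemma sum_rd_of_pos {α : ℝ} (hα : 0 < α) (hα' : α < 1) {ι : Type*} [Fintype ι]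
    (V : ι → ProbabilityMeasure Y) {p : ι → ℝ} (hp : ∀ i, 0 < p i) {Q : ProbabilityMeasure Y}
    (h : ∀ i, 0 < (aff α (V i : Measure Y) Q).toReal) :
    ∑ i, ENNReal.ofReal (p i) * rd α (V i) Q =
      ENNReal.ofReal ((α - 1)⁻¹ * ∑ i, p i * Real.log (aff α (V i : Measure Y) Q).toReal) := by
  have h1 : ∀ i, 0 ≤ (α - 1)⁻¹ * Real.log (aff α (V i : Measure Y) Q).toReal := fun i =>
    mul_nonneg_of_nonpos_of_nonpos (inv_nonpos.2 (by linarith)) (Real.log_nonpos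
      ENNReal.toReal_nonneg (ENNReal.toReal_mono ENNReal.one_ne_top (aff_le_one hα hα' _ _)))
  rw [Finset.mul_sum, ENNReal.ofReal_sum_of_nonneg fun i _ => by
    have := mul_nonneg (hp i).le (h1 i)
    linarith]
  refine Finset.sum_congr rfl fun i _ => ?_
  rw [rd_eq_ofReal hα hα' (ENNReal.toReal_pos_iff.1 (h i)).1.ne', ← ENNReal.ofReal_mul (hp i).le]
  congr 1; ring

lemma aff_pos_of_sum_rd_lt_top {α : ℝ} (hα : 0 < α) (hα' : α < 1) {ι : Type*} [Fintype ι]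
    (V : ι → ProbabilityMeasure Y) {p : ι → ℝ} (hp : ∀ i, 0 < p i) {Q : ProbabilityMeasure Y}
    (h : ∑ i, ENNReal.ofReal (p i) * rd α (V i) Q ≠ ⊤) (i : ι) :
    0 < (aff α (V i : Measure Y) Q).toReal := by
  refine ENNReal.toReal_pos (fun h0 => h ?_)
    (ne_top_of_le_ne_top ENNReal.one_ne_top (aff_le_one hα hα' _ _))
  refine ENNReal.sum_eq_top.2 ⟨i, Finset.mem_univ i, ?_⟩
  rw [rd_eq_top hα hα' h0, ENNReal.mul_top (ENNReal.ofReal_pos.2 (hp i)).ne']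

/-- The vector of affinities at the infimum of the conditional divergence, together with the
variational inequality it satisfies. -/
lemma exists_optimal_aff {α : ℝ} (hα : 0 < α) (hα' : α < 1) {ι : Type*} [Fintype ι]
    (V : ι → ProbabilityMeasure Y) {p : ι → ℝ} (hp : ∀ i, 0 < p i) (hs : ∑ i, p i = 1)
    (hfin : ⨅ Q : ProbabilityMeasure Y, ∑ i, ENNReal.ofReal (p i) * rd α (V i) Q < ⊤) :
    ∃ t : ι → ℝ, (∀ i, 0 < t i) ∧ (∀ i, t i ≤ 1) ∧
      (∀ Q : ProbabilityMeasure Y, ∑ i, p i * ((aff α (V i : Measure Y) Q).toReal / t i) ≤ 1) ∧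
      ⨅ Q : ProbabilityMeasure Y, ∑ i, ENNReal.ofReal (p i) * rd α (V i) Q ≤
        ENNReal.ofReal ((α - 1)⁻¹ * ∑ i, p i * Real.log (t i)) := by
  set T : ProbabilityMeasure Y → ι → ℝ := fun Q i => (aff α (V i : Measure Y) Q).toReal with hT
  set F : (ι → ℝ) → ℝ := fun t => ∏ i, t i ^ p i with hF
  have hFc : Continuous F := continuous_finsetProd _ fun i _ =>
    (continuous_apply i).rpow_const fun _ => Or.inr (hp i).le
  -- Compactness is used for vectors of affinities, not for measures, so the maximiser t need not
  -- come from any Q.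
  set B : Set (ι → ℝ) := Set.pi Set.univ fun _ => Set.Icc (0 : ℝ) 1 with hB
  have hBc : IsCompact B := isCompact_univ_pi fun _ => isCompact_Icc
  have hTB : closure (Set.range T) ⊆ B := by
    refine closure_minimal ?_ hBc.isClosed
    rintro _ ⟨Q, rfl⟩ i -
    exact ⟨ENNReal.toReal_nonneg,
      ENNReal.toReal_mono ENNReal.one_ne_top (aff_le_one hα hα' _ _)⟩
  obtain ⟨Q₀, hQ₀⟩ := iInf_lt_iff.1 hfin
  have hTQ₀ := aff_pos_of_sum_rd_lt_top hα hα' V hp hQ₀.ne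
  obtain ⟨t, htK, htmax⟩ := (hBc.of_isClosed_subset isClosed_closure hTB).exists_isMaxOn
    ⟨T Q₀, subset_closure ⟨Q₀, rfl⟩⟩ hFc.continuousOn
  have hmax : ∀ u ∈ closure (Set.range T), F u ≤ F t := fun u hu => htmax hu
  have hFt : 0 < F t := lt_of_lt_of_le (Finset.prod_pos fun i _ => Real.rpow_pos_of_pos (hTQ₀ i) _)
    (hmax _ (subset_closure ⟨Q₀, rfl⟩))
  have ht0 : ∀ i, 0 < t i := by
    intro i
    refine lt_of_le_of_ne (hTB htK i (Set.mem_univ i)).1 fun h => hFt.ne' ?_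
    exact Finset.prod_eq_zero (Finset.mem_univ i) (by rw [← h, Real.zero_rpow (hp i).ne'])
  refine ⟨t, ht0, fun i => (hTB htK i (Set.mem_univ i)).2, fun Q => ?_, ?_⟩
  · refine sum_mul_le_one_of_prod_le hp hs (fun i => div_nonneg ENNReal.toReal_nonneg (ht0 i).le)
      fun l hl => ?_
    have hl1 : 0 ≤ 1 - l := by linarith [hl.2]
    have hmix : ∀ u ∈ closure (Set.range T), F (fun i => (1 - l) * u i + l * T Q i) ≤ F t := by
      intro u hu
      -- The inequality is a closed condition on u, so it suffices to check vectors that come from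
      -- measures, where mixtures are available.
      have hclosed : IsClosed {u : ι → ℝ | F (fun i => (1 - l) * u i + l * T Q i) ≤ F t} := by
        refine isClosed_le (hFc.comp ?_) continuous_const
        fun_prop
      refine closure_minimal ?_ hclosed hu
      rintro _ ⟨R, rfl⟩
      obtain ⟨m, hm⟩ := exists_mixture R Q hl.1.le hl.2.le
      refine le_trans (Finset.prod_le_prod (fun i _ => Real.rpow_nonneg ?_ _) fun i _ =>
        Real.rpow_le_rpow ?_ (aff_mixture hα hα' (V i) R Q m hl.1.le hl.2.le hm) (hp i).le)
        (hmax (T m) (subset_closure ⟨m, rfl⟩))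
      · exact add_nonneg (mul_nonneg hl1 ENNReal.toReal_nonneg)
          (mul_nonneg hl.1.le ENNReal.toReal_nonneg)
      · exact add_nonneg (mul_nonneg hl1 ENNReal.toReal_nonneg)
          (mul_nonneg hl.1.le ENNReal.toReal_nonneg)
    have h1 := hmix t htK
    have h2 : F (fun i => (1 - l) * t i + l * T Q i) =
        F t * ∏ i, ((1 - l) + l * (T Q i / t i)) ^ p i := by
      rw [hF]
      dsimp only
      rw [← Finset.prod_mul_distrib]
      refine Finset.prod_congr rfl fun i _ => ?_
      have h3 : 0 ≤ T Q i / t i := div_nonneg ENNReal.toReal_nonneg (ht0 i).le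
      rw [← Real.mul_rpow (ht0 i).le (add_nonneg hl1 (mul_nonneg hl.1.le h3))]
      congr 1
      have := (ht0 i).ne'
      field_simp
    rw [h2] at h1
    exact (mul_le_iff_le_one_right hFt).1 h1
  · obtain ⟨u, huT, hu⟩ := mem_closure_iff_seq_limit.1 htK
    choose Q hQ using huT
    have hui : ∀ i, Tendsto (fun n => u n i) atTop (𝓝 (t i)) := fun i =>
      (tendsto_pi_nhds.1 hu) i
    have hpos : ∀ᶠ n in atTop, ∀ i, 0 < u n i :=
      eventually_all.2 fun i => (hui i).eventually_const_lt (ht0 i)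
    have hlim : Tendsto (fun n => ENNReal.ofReal ((α - 1)⁻¹ * ∑ i, p i * Real.log (u n i))) atTop
        (𝓝 (ENNReal.ofReal ((α - 1)⁻¹ * ∑ i, p i * Real.log (t i)))) := by
      refine ENNReal.tendsto_ofReal (Tendsto.const_mul _ (tendsto_finsetSum _ fun i _ => ?_))
      exact ((hui i).log (ht0 i).ne').const_mul _
    refine ge_of_tendsto hlim ?_
    filter_upwards [hpos] with n hn
    refine (iInf_le _ (Q n)).trans (le_of_eq ?_)
    have hi : ∀ i, u n i = (aff α (V i : Measure Y) (Q n)).toReal := fun i =>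
      (congrFun (hQ n) i).symm
    simp_rw [hi] at hn ⊢
    exact sum_rd_of_pos hα hα' V hp hn

/-- A weighted sum of affinities is proportional to the affinity of a single measure. -/
lemma exists_aff_eq_sum {α : ℝ} (hα : 0 < α) (hα' : α < 1) {ι : Type*} [Fintype ι] [Nonempty ι]
    (V : ι → ProbabilityMeasure Y) {c : ι → ℝ} (hc : ∀ i, 0 < c i) :
    ∃ (q : ProbabilityMeasure Y) (z : ℝ), 0 < z ∧ ∀ Q : ProbabilityMeasure Y,
      ∑ i, c i * (aff α (V i : Measure Y) Q).toReal = z ^ α * (aff α (q : Measure Y) Q).toReal := by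
  obtain ⟨ν, hν, hV⟩ := exists_dominating fun i => (V i : Measure Y)
  have hafin : ∀ w Q : ProbabilityMeasure Y, aff α (w : Measure Y) Q ≠ ⊤ := fun w Q =>
    ne_top_of_le_ne_top ENNReal.one_ne_top (aff_le_one hα hα' _ _)
  -- the unnormalised density, for an arbitrary reference measure
  set g : Measure Y → Y → ℝ := fun μ y => (∑ i, c i * dens μ (V i) y ^ α) ^ α⁻¹ with hg
  have hg0 : ∀ (μ : Measure Y) (y : Y), 0 ≤ ∑ i, c i * dens μ (V i) y ^ α := fun μ y =>
    Finset.sum_nonneg fun i _ => mul_nonneg (hc i).le (Real.rpow_nonneg (dens_nonneg _ _ _) _)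
  have hgm : ∀ μ, Measurable (g μ) := fun μ => by
    simp only [hg]
    fun_prop
  have hgnn : ∀ μ y, 0 ≤ g μ y := fun μ y => Real.rpow_nonneg (hg0 μ y) _
  set Z : ℝ≥0∞ := ∫⁻ y, ENNReal.ofReal (g ν y) ∂ν with hZ
  have hZfin : Z ≠ ⊤ := by
    have hb : ∀ y, g ν y ≤ (∑ i, c i) ^ α⁻¹ * ∑ i, dens ν (V i) y := by
      intro y
      have hs0 : 0 ≤ ∑ i, dens ν (V i) y := Finset.sum_nonneg fun i _ => dens_nonneg _ _ _
      have hc0 : 0 ≤ ∑ i, c i := Finset.sum_nonneg fun i _ => (hc i).le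
      have h1 : ∑ i, c i * dens ν (V i) y ^ α ≤ (∑ i, c i) * (∑ i, dens ν (V i) y) ^ α := by
        rw [Finset.sum_mul]
        refine Finset.sum_le_sum fun i _ => mul_le_mul_of_nonneg_left ?_ (hc i).le
        exact Real.rpow_le_rpow (dens_nonneg _ _ _) (Finset.single_le_sum
          (f := fun i => dens ν (V i) y) (fun i _ => dens_nonneg _ _ _) (Finset.mem_univ i)) hα.le
      refine (Real.rpow_le_rpow (hg0 ν y) h1 (inv_nonneg.2 hα.le)).trans (le_of_eq ?_)
      rw [Real.mul_rpow hc0 (Real.rpow_nonneg hs0 _), Real.rpow_rpow_inv hs0 hα.ne']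
    refine ne_top_of_le_ne_top ?_ (lintegral_mono fun y => ENNReal.ofReal_le_ofReal (hb y))
    have hc0 : 0 ≤ (∑ i, c i) ^ α⁻¹ := Real.rpow_nonneg (Finset.sum_nonneg fun i _ => (hc i).le) _
    simp_rw [ENNReal.ofReal_mul hc0,
      ENNReal.ofReal_sum_of_nonneg fun (i : ι) _ => dens_nonneg ν (V i) _]
    rw [lintegral_const_mul _ (by fun_prop), lintegral_finsetSum _ (by fun_prop)]
    refine ENNReal.mul_ne_top ENNReal.ofReal_ne_top (ENNReal.sum_ne_top.2 fun i _ => ?_)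
    rw [lintegral_dens (hV i)]
    exact measure_ne_top _ _
  have hZ0 : Z ≠ 0 := by
    intro h0
    rw [hZ, lintegral_eq_zero_iff (by fun_prop)] at h0
    obtain ⟨i⟩ := ‹Nonempty ι›
    have h1 : ∫⁻ y, ENNReal.ofReal (dens ν (V i) y) ∂ν = 0 := by
      rw [lintegral_eq_zero_iff (by fun_prop)]
      filter_upwards [h0] with y hy
      have h2 : g ν y = 0 := le_antisymm (ENNReal.ofReal_eq_zero.1 hy) (hgnn ν y)
      have h3 : ∑ i, c i * dens ν (V i) y ^ α = 0 :=
        (Real.rpow_eq_zero (hg0 ν y) (inv_ne_zero hα.ne')).1 h2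
      have h4 := (Finset.sum_eq_zero_iff_of_nonneg fun i _ =>
        mul_nonneg (hc i).le (Real.rpow_nonneg (dens_nonneg _ _ _) _)).1 h3 i (Finset.mem_univ i)
      have h5 := (mul_eq_zero.1 h4).resolve_left (hc i).ne'
      rw [(Real.rpow_eq_zero (dens_nonneg _ _ _) hα.ne').1 h5]
      simp
    rw [lintegral_dens (hV i), measure_univ] at h1
    exact one_ne_zero h1
  set z : ℝ := Z.toReal with hz
  have hzpos : 0 < z := ENNReal.toReal_pos hZ0 hZfin
  have hprob : IsProbabilityMeasure (ν.withDensity fun y => ENNReal.ofReal (g ν y / z)) := by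
    refine ⟨?_⟩
    rw [withDensity_apply _ MeasurableSet.univ, Measure.restrict_univ]
    simp_rw [div_eq_mul_inv, ENNReal.ofReal_mul (hgnn ν _)]
    rw [lintegral_mul_const _ (by fun_prop), ← hZ, ENNReal.ofReal_inv_of_pos hzpos, hz,
      ENNReal.ofReal_toReal hZfin, ENNReal.mul_inv_cancel hZ0 hZfin]
  refine ⟨⟨_, hprob⟩, z, hzpos, fun Q => ?_⟩
  set q : ProbabilityMeasure Y := ⟨_, hprob⟩ with hq
  set ν' : Measure Y := ν + Q with hν'
  have hνν' : ν ≪ ν' := ac_add_left _ _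
  have hQ : (Q : Measure Y) ≪ ν' := ac_add_right _ _
  have hVν' : ∀ i, (V i : Measure Y) ≪ ν' := fun i => (hV i).trans hνν'
  have hqeq : (q : Measure Y) = ν'.withDensity fun y => ENNReal.ofReal (g ν' y / z) := by
    rw [hq, ProbabilityMeasure.coe_mk, withDensity_chain hνν' ((hgm ν).div_const z)]
    refine withDensity_congr_ae ?_
    have hch : ∀ᵐ y ∂ν', ∀ i, dens ν' (V i) y = dens ν' ν y * dens ν (V i) y :=
      ae_all_iff.2 fun i => dens_chain (hV i)
    filter_upwards [hch] with y hy
    congr 1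
    rw [← mul_div_assoc]
    congr 1
    simp only [hg, hy]
    have hd := dens_nonneg ν' ν y
    have : ∑ i, c i * (dens ν' ν y * dens ν (V i) y) ^ α =
        dens ν' ν y ^ α * ∑ i, c i * dens ν (V i) y ^ α := by
      rw [Finset.mul_sum]
      refine Finset.sum_congr rfl fun i _ => ?_
      rw [Real.mul_rpow hd (dens_nonneg _ _ _)]; ring
    rw [this, Real.mul_rpow (Real.rpow_nonneg hd _) (hg0 ν y), Real.rpow_rpow_inv hd hα.ne']
  have hqν' : (q : Measure Y) ≪ ν' := hqeq ▸ withDensity_absolutelyContinuous _ _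
  have hmeas : ∀ a b : Measure Y, Measurable fun y => affFun α (dens ν' a y) (dens ν' b y) :=
    fun a b => (measurable_affFun α).comp ((measurable_dens _ _).prodMk (measurable_dens _ _))
  have key : ∑ i, ENNReal.ofReal (c i) * aff α (V i : Measure Y) Q =
      ENNReal.ofReal (z ^ α) * aff α (q : Measure Y) Q := by
    simp_rw [aff_eq hα hα'.le (hVν' _) hQ]
    rw [aff_eq hα hα'.le hqν' hQ]
    unfold persp
    simp_rw [← lintegral_const_mul _ (hmeas _ _)]
    rw [← lintegral_finsetSum _ fun i _ => (hmeas _ _).const_mul _]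
    refine lintegral_congr_ae ?_
    have hdq := dens_withDensity ν' ((hgm ν').div_const z)
      fun y => div_nonneg (hgnn ν' y) hzpos.le
    rw [← hqeq] at hdq
    filter_upwards [hdq] with y hy
    unfold affFun
    simp_rw [← ENNReal.ofReal_mul (hc _).le]
    rw [← ENNReal.ofReal_sum_of_nonneg fun i _ => mul_nonneg (hc i).le (mul_nonneg
      (Real.rpow_nonneg (dens_nonneg _ _ _) _) (Real.rpow_nonneg (dens_nonneg _ _ _) _)),
      ← ENNReal.ofReal_mul (Real.rpow_nonneg hzpos.le _), hy]
    congr 1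
    simp_rw [← mul_assoc]
    rw [← Finset.sum_mul, ← Real.mul_rpow hzpos.le (div_nonneg (hgnn _ _) hzpos.le),
      mul_div_cancel₀ _ hzpos.ne']
    simp only [hg]
    rw [Real.rpow_inv_rpow (hg0 _ _) hα.ne']
  have := congrArg ENNReal.toReal key
  rw [ENNReal.toReal_sum fun i _ => ENNReal.mul_ne_top ENNReal.ofReal_ne_top (hafin _ _),
    ENNReal.toReal_mul, ENNReal.toReal_ofReal (Real.rpow_nonneg hzpos.le _)] at this
  rw [← this]
  refine Finset.sum_congr rfl fun i _ => ?_
  rw [ENNReal.toReal_mul, ENNReal.toReal_ofReal (hc i).le]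

lemma exists_mean_of_lt_one {α : ℝ} (hα : 0 < α) (hα' : α < 1) {ι : Type*} [Fintype ι]
    (V : ι → ProbabilityMeasure Y) {p : ι → ℝ} (hp : ∀ i, 0 < p i) (hs : ∑ i, p i = 1)
    (hfin : ⨅ Q : ProbabilityMeasure Y, ∑ i, ENNReal.ofReal (p i) * rd α (V i) Q < ⊤) :
    ∃ q : ProbabilityMeasure Y, ∀ Q : ProbabilityMeasure Y,
      (⨅ Q : ProbabilityMeasure Y, ∑ i, ENNReal.ofReal (p i) * rd α (V i) Q) + rd α q Q ≤
        ∑ i, ENNReal.ofReal (p i) * rd α (V i) Q := by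
  have hne : Nonempty ι := by
    by_contra h
    rw [not_nonempty_iff] at h
    simp at hs
  obtain ⟨t, ht0, ht1, htQ, htI⟩ := exists_optimal_aff hα hα' V hp hs hfin
  obtain ⟨q, z, hz, hq⟩ := exists_aff_eq_sum hα hα' V (c := fun i => p i / t i)
    fun i => div_pos (hp i) (ht0 i)
  have hR : ∀ Q : ProbabilityMeasure Y, ∑ i, p i * ((aff α (V i : Measure Y) Q).toReal / t i) =
      z ^ α * (aff α (q : Measure Y) Q).toReal := by
    intro Q
    rw [← hq Q]
    exact Finset.sum_congr rfl fun i _ => by ring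
  have hz1 : z ^ α ≤ 1 := by
    -- The variational inequality tested at Q = q, where the affinity is 1, bounds the normalising
    -- constant.
    have h1 := htQ q
    rwa [hR q, aff_self hα hα'.le, ENNReal.toReal_one, mul_one] at h1
  refine ⟨q, fun Q => ?_⟩
  by_cases htop : ∑ i, ENNReal.ofReal (p i) * rd α (V i) Q = ⊤
  · rw [htop]; exact le_top
  have hT := aff_pos_of_sum_rd_lt_top hα hα' V hp htop
  set R := ∑ i, p i * ((aff α (V i : Measure Y) Q).toReal / t i) with hRdef
  have hRpos : 0 < R := Finset.sum_pos
    (fun i _ => mul_pos (hp i) (div_pos (hT i) (ht0 i))) Finset.univ_nonempty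
  have hRa : R ≤ (aff α (q : Measure Y) Q).toReal := by
    rw [hRdef, hR Q]
    exact mul_le_of_le_one_left ENNReal.toReal_nonneg hz1
  have ha1 : (aff α (q : Measure Y) Q).toReal ≤ 1 :=
    ENNReal.toReal_mono ENNReal.one_ne_top (aff_le_one hα hα' _ _)
  have hapos := hRpos.trans_le hRa
  have hinv : (α - 1)⁻¹ ≤ 0 := inv_nonpos.2 (by linarith)
  refine (add_le_add_left htI _).trans ?_
  rw [sum_rd_of_pos hα hα' V hp hT, rd_eq_ofReal hα hα' (ENNReal.toReal_pos_iff.1 hapos).1.ne',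
    ← ENNReal.ofReal_add (mul_nonneg_of_nonpos_of_nonpos hinv (Finset.sum_nonpos fun i _ =>
      mul_nonpos_of_nonneg_of_nonpos (hp i).le (Real.log_nonpos (ht0 i).le (ht1 i))))
      (mul_nonneg_of_nonpos_of_nonpos hinv (Real.log_nonpos hapos.le ha1)), ← mul_add]
  refine ENNReal.ofReal_le_ofReal (mul_le_mul_of_nonpos_left ?_ hinv)
  have h1 : ∀ i, p i * Real.log (aff α (V i : Measure Y) Q).toReal ≤ p i * Real.log (t i) +
      p i * ((aff α (V i : Measure Y) Q).toReal / t i) / R - p i + p i * Real.log R := by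
    intro i
    -- Jensen's inequality by the tangent to the logarithm at the mean R of the ratios aff / t.
    have h2 := Real.log_le_sub_one_of_pos (div_pos (div_pos (hT i) (ht0 i)) hRpos)
    rw [Real.log_div (div_pos (hT i) (ht0 i)).ne' hRpos.ne',
      Real.log_div (hT i).ne' (ht0 i).ne'] at h2
    have h3 := mul_le_mul_of_nonneg_left h2 (hp i).le
    rw [mul_div_assoc]
    linarith
  refine (Finset.sum_le_sum fun i _ => h1 i).trans ?_
  rw [Finset.sum_add_distrib, Finset.sum_sub_distrib, Finset.sum_add_distrib, ← Finset.sum_div,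
    ← hRdef, ← Finset.sum_mul, hs, div_self hRpos.ne', one_mul]
  have := Real.log_le_log hRpos hRa
  linarith

/-- Every finite family with positive weights has a mean satisfying the Erven–Harremoës bound. -/
lemma exists_mean {α : ℝ} (hα : 0 < α) (hα' : α ≤ 1) {ι : Type*} [Fintype ι]
    (V : ι → ProbabilityMeasure Y) {p : ι → ℝ} (hp : ∀ i, 0 < p i) (hs : ∑ i, p i = 1)
    (hfin : ⨅ Q : ProbabilityMeasure Y, ∑ i, ENNReal.ofReal (p i) * rd α (V i) Q < ⊤) :
    ∃ q : ProbabilityMeasure Y, ∀ Q : ProbabilityMeasure Y,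
      (⨅ Q : ProbabilityMeasure Y, ∑ i, ENNReal.ofReal (p i) * rd α (V i) Q) + rd α q Q ≤
        ∑ i, ENNReal.ofReal (p i) * rd α (V i) Q := by
  rcases hα'.eq_or_lt with rfl | hα'
  · obtain ⟨q, hq⟩ := exists_mean_of_eq_one V hp hs
    exact ⟨q, fun Q => (add_le_add_left (iInf_le _ q) _).trans (hq Q)⟩
  · exact exists_mean_of_lt_one hα hα' V hp hs hfin

/-! ### Conditional divergence and information of a channel -/

variable {X : Type*}

/-- The conditional Rényi divergence as an extended nonnegative real. -/
noncomputable def cond (α : ℝ) (W : X → ProbabilityMeasure Y) (P : X →₀ ℝ)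
    (Q : ProbabilityMeasure Y) : ℝ≥0∞ :=
  ∑ x ∈ P.support, ENNReal.ofReal (P x) * rd α (W x) Q

/-- The Augustin information as an extended nonnegative real. -/
noncomputable def info (α : ℝ) (W : X → ProbabilityMeasure Y) (P : X →₀ ℝ) : ℝ≥0∞ :=
  ⨅ Q : ProbabilityMeasure Y, cond α W P Q

lemma coe_cond {α : ℝ} (hα : 0 < α) (hα' : α ≤ 1) (W : X → ProbabilityMeasure Y) {P : X →₀ ℝ}
    (hP : P ∈ finPMF X) (Q : ProbabilityMeasure Y) :
    (cond α W P Q : EReal) = condRenyiDiv α W Q P := by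
  have hsum : ∀ (s : Finset X) (f : X → ℝ≥0∞), ((∑ x ∈ s, f x : ℝ≥0∞) : EReal) =
      ∑ x ∈ s, (f x : EReal) := by
    classical
    intro s f
    induction s using Finset.induction_on with
    | empty => simp
    | insert a s ha ih =>
      rw [Finset.sum_insert ha, Finset.sum_insert ha, EReal.coe_ennreal_add, ih]
  rw [cond, condRenyiDiv, Finsupp.sum, hsum]
  refine Finset.sum_congr rfl fun x _ => ?_
  rw [EReal.coe_ennreal_mul, coe_rd hα hα', EReal.coe_ennreal_ofReal, max_eq_left (hP.1 x)]

lemma coe_iInf_ennreal {ι : Sort*} (f : ι → ℝ≥0∞) :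
    ((⨅ i, f i : ℝ≥0∞) : EReal) = ⨅ i, (f i : EReal) := by
  refine le_antisymm (le_iInf fun i => EReal.coe_ennreal_le_coe_ennreal_iff.2 (iInf_le f i)) ?_
  have h0 : (0 : EReal) ≤ ⨅ i, (f i : EReal) := le_iInf fun i => EReal.coe_ennreal_nonneg _
  rw [← EReal.coe_toENNReal h0, EReal.coe_ennreal_le_coe_ennreal_iff]
  refine le_iInf fun i => ?_
  rw [← EReal.coe_ennreal_le_coe_ennreal_iff, EReal.coe_toENNReal h0]
  exact iInf_le (fun i => (f i : EReal)) i

/-- Nonemptiness matters: the empty supremum is `0` in `ℝ≥0∞` but `⊥` in `EReal`. -/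
lemma coe_biSup_ennreal {ι : Type*} {s : Set ι} (hs : s.Nonempty) (f : ι → ℝ≥0∞) :
    ((⨆ i ∈ s, f i : ℝ≥0∞) : EReal) = ⨆ i ∈ s, (f i : EReal) := by
  obtain ⟨j, hj⟩ := hs
  have h0 : (0 : EReal) ≤ ⨆ i ∈ s, (f i : EReal) :=
    le_trans (EReal.coe_ennreal_nonneg (f j)) (le_biSup (fun i => (f i : EReal)) hj)
  refine le_antisymm ?_ (iSup₂_le fun i hi =>
    EReal.coe_ennreal_le_coe_ennreal_iff.2 (le_biSup f hi))
  rw [← EReal.coe_toENNReal h0, EReal.coe_ennreal_le_coe_ennreal_iff]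
  refine iSup₂_le fun i hi => ?_
  rw [← EReal.coe_ennreal_le_coe_ennreal_iff, EReal.coe_toENNReal h0]
  exact le_biSup (fun i => (f i : EReal)) hi

lemma cond_eq_sum_of_subset {α : ℝ} (W : X → ProbabilityMeasure Y) {P : X →₀ ℝ} {s : Finset X}
    (h : P.support ⊆ s) (Q : ProbabilityMeasure Y) :
    cond α W P Q = ∑ x ∈ s, ENNReal.ofReal (P x) * rd α (W x) Q :=
  Finset.sum_subset h fun x _ hx => by simp [Finsupp.notMem_support_iff.1 hx]

lemma cond_convex_combination {α : ℝ} (W : X → ProbabilityMeasure Y) {P₁ P₂ : X →₀ ℝ}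
    (h₁ : P₁ ∈ finPMF X) (h₂ : P₂ ∈ finPMF X) {a b : ℝ} (ha : 0 ≤ a) (hb : 0 ≤ b)
    (Q : ProbabilityMeasure Y) :
    cond α W (a • P₁ + b • P₂) Q =
      ENNReal.ofReal a * cond α W P₁ Q + ENNReal.ofReal b * cond α W P₂ Q := by
  classical
  have h : (a • P₁ + b • P₂).support ⊆ P₁.support ∪ P₂.support :=
    Finsupp.support_add.trans (Finset.union_subset_union Finsupp.support_smul Finsupp.support_smul)
  rw [cond_eq_sum_of_subset W h, cond_eq_sum_of_subset W Finset.subset_union_left,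
    cond_eq_sum_of_subset W Finset.subset_union_right, Finset.mul_sum, Finset.mul_sum,
    ← Finset.sum_add_distrib]
  refine Finset.sum_congr rfl fun x _ => ?_
  rw [Finsupp.add_apply, Finsupp.smul_apply, Finsupp.smul_apply, smul_eq_mul, smul_eq_mul,
    ENNReal.ofReal_add (mul_nonneg ha (h₁.1 x)) (mul_nonneg hb (h₂.1 x)), ENNReal.ofReal_mul ha,
    ENNReal.ofReal_mul hb]
  ring

/-- The Erven–Harremoës bound for a single input distribution. -/
lemma exists_mean_info {α : ℝ} (hα : 0 < α) (hα' : α ≤ 1) (W : X → ProbabilityMeasure Y)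
    {P : X →₀ ℝ} (hP : P ∈ finPMF X) (hfin : info α W P < ⊤) :
    ∃ q : ProbabilityMeasure Y, ∀ Q : ProbabilityMeasure Y,
      info α W P + rd α q Q ≤ cond α W P Q := by
  have hc : ∀ Q, ∑ i : P.support, ENNReal.ofReal (P i) * rd α (W i) Q = cond α W P Q := fun Q =>
    Finset.sum_coe_sort P.support fun x => ENNReal.ofReal (P x) * rd α (W x) Q
  have hs : ∑ i : P.support, P i = 1 := (Finset.sum_coe_sort P.support fun x => P x).trans hP.2
  have := exists_mean hα hα' (fun i : P.support => W i) (p := fun i => P i)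
    (fun i => lt_of_le_of_ne (hP.1 i) (Finsupp.mem_support_iff.1 i.2).symm) hs
    (by simp_rw [hc]; exact hfin)
  simp_rw [hc] at this
  exact this

lemma hell_comm (p q : Measure Y) [IsFiniteMeasure p] [IsFiniteMeasure q] :
    hell p q = hell q p := by
  rw [hell_eq (ac_add_left p q) (ac_add_right p q), hell_eq (ac_add_right p q) (ac_add_left p q),
    eLpNorm_sub_comm]

lemma tendsto_hell_of_tendsto_rd {α : ℝ} (hα : 0 < α) (hα' : α ≤ 1)
    {p q : ℕ → ProbabilityMeasure Y} (h : Tendsto (fun n => rd α (p n) (q n)) atTop (𝓝 0)) :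
    Tendsto (fun n => hell (p n : Measure Y) (q n)) atTop (𝓝 0) := by
  set c : ℝ≥0∞ := ENNReal.ofReal (gapConst α) with hc
  have hc0 : c ≠ 0 := (ENNReal.ofReal_pos.2 (gapConst_pos hα hα')).ne'
  have h1 : Tendsto (fun n => (rd α (p n) (q n) / c) ^ (1 / 2 : ℝ)) atTop (𝓝 0) := by
    have h2 : Tendsto (fun n => rd α (p n) (q n) / c) atTop (𝓝 (0 / c)) :=
      ENNReal.Tendsto.div_const h (Or.inr hc0)
    have h3 := (ENNReal.continuous_rpow_const (y := 1 / 2)).continuousAt.tendsto.comp h2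
    rw [ENNReal.zero_div, ENNReal.zero_rpow_of_pos (by norm_num)] at h3
    exact h3
  refine tendsto_of_tendsto_of_tendsto_of_le_of_le tendsto_const_nhds h1 (fun _ => zero_le)
    fun n => hell_le_of_rd_le hα hα' ?_
  rw [← ENNReal.rpow_natCast, ← ENNReal.rpow_mul]
  norm_num
  rw [ENNReal.mul_div_cancel hc0 ENNReal.ofReal_ne_top]

/-- Fatou's lemma for counting measure on a two-point space. -/
lemma liminf_add_liminf_le (u v : ℕ → ℝ≥0∞) :
    liminf u atTop + liminf v atTop ≤ liminf (fun n => u n + v n) atTop := by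
  have h := lintegral_liminf_le (μ := Measure.count) (u := atTop)
    (f := fun n (b : Bool) => if b then u n else v n) fun n => measurable_from_top
  simpa [lintegral_count, tsum_bool] using h

lemma sum_mul_liminf_le {ι : Type*} (s : Finset ι) {a : ι → ℝ≥0∞} (ha : ∀ i, a i ≠ ⊤)
    (u : ι → ℕ → ℝ≥0∞) :
    ∑ i ∈ s, a i * liminf (u i) atTop ≤ liminf (fun n => ∑ i ∈ s, a i * u i n) atTop := by
  classical
  induction s using Finset.induction_on with
  | empty => simp
  | insert i s hi ih =>
    simp_rw [Finset.sum_insert hi]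
    have h1 : a i * liminf (u i) atTop = liminf (fun n => a i * u i n) atTop :=
      Monotone.map_liminf_of_continuousAt (fun _ _ h => mul_le_mul_right h _) (u i)
        (ENNReal.continuous_const_mul (ha i)).continuousAt
    rw [h1]
    exact (add_le_add le_rfl ih).trans (liminf_add_liminf_le _ _)

/-- A sublevel set of the conditional divergence is closed for Hellinger convergence. -/
lemma cond_le_of_tendsto {α : ℝ} (hα : 0 < α) (hα' : α ≤ 1) (W : X → ProbabilityMeasure Y)
    (P : X →₀ ℝ) {Q : ℕ → ProbabilityMeasure Y} {q : ProbabilityMeasure Y}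
    (hQ : Tendsto (fun n => hell (Q n : Measure Y) q) atTop (𝓝 0)) {u : ℕ → ℝ≥0∞} {c : ℝ≥0∞}
    (hu : Tendsto u atTop (𝓝 c)) (h : ∀ n, cond α W P (Q n) ≤ u n) : cond α W P q ≤ c := by
  obtain ⟨μ, hμ, hac⟩ := exists_dominating fun x : P.support => (W x : Measure Y)
  obtain ⟨k, hk, hlsc⟩ := exists_subseq_le_liminf hα hα' hQ μ
  calc cond α W P q ≤ ∑ x ∈ P.support, ENNReal.ofReal (P x) *
        liminf (fun n => rd α (W x) (Q (k n))) atTop :=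
        Finset.sum_le_sum fun x hx => mul_le_mul_right (hlsc (W x) (hac ⟨x, hx⟩)).1 _
    _ ≤ liminf (fun n => cond α W P (Q (k n))) atTop :=
        sum_mul_liminf_le _ (fun _ => ENNReal.ofReal_ne_top) _
    _ ≤ liminf (fun n => u (k n)) atTop := liminf_le_liminf (Eventually.of_forall fun n => h (k n))
    _ = c := (hu.comp hk.tendsto_atTop).liminf_eq

/-! ### Construction of the center -/

/-- Comparison of a mean with a nearly optimal output distribution of a mixture. -/
lemma exists_near_optimal {α : ℝ} {W : X → ProbabilityMeasure Y} {A : Set (X →₀ ℝ)}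
    (hA : A ⊆ finPMF X) (hconv : Convex ℝ A) (hfin : ⨆ P ∈ A, info α W P ≠ ⊤) {P₁ P₂ : X →₀ ℝ}
    (h₁ : P₁ ∈ A) (h₂ : P₂ ∈ A) {q : ProbabilityMeasure Y}
    (hq : ∀ Q, info α W P₁ + rd α q Q ≤ cond α W P₁ Q) {e l : ℝ} (he : 0 < e)
    (hI : ⨆ P ∈ A, info α W P ≤ info α W P₁ + ENNReal.ofReal e) (hl : l ∈ Set.Ioo (0 : ℝ) 1) :
    ∃ Q : ProbabilityMeasure Y, rd α q Q ≠ ⊤ ∧ cond α W P₂ Q ≠ ⊤ ∧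
      (1 - l) * ((⨆ P ∈ A, info α W P).toReal + (rd α q Q).toReal) +
        l * (cond α W P₂ Q).toReal ≤ (⨆ P ∈ A, info α W P).toReal + 2 * e := by
  set C := ⨆ P ∈ A, info α W P with hC
  have hl0 : 0 < 1 - l := by linarith [hl.2]
  have hmem : (1 - l) • P₁ + l • P₂ ∈ A := hconv h₁ h₂ hl0.le hl.1.le (by ring)
  have hlt : info α W ((1 - l) • P₁ + l • P₂) < C + ENNReal.ofReal e :=
    (le_biSup (info α W) hmem).trans_lt
      (ENNReal.lt_add_right hfin (ENNReal.ofReal_pos.2 he).ne')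
  obtain ⟨Q, hQ⟩ := iInf_lt_iff.1 hlt
  rw [cond_convex_combination W (hA h₁) (hA h₂) hl0.le hl.1.le] at hQ
  have h3 : C + rd α q Q ≤ cond α W P₁ Q + ENNReal.ofReal e :=
    calc C + rd α q Q ≤ info α W P₁ + ENNReal.ofReal e + rd α q Q := add_le_add_left hI _
      _ = info α W P₁ + rd α q Q + ENNReal.ofReal e := by ring
      _ ≤ _ := add_le_add_left (hq Q) _
  have hfin' : ENNReal.ofReal (1 - l) * cond α W P₁ Q + ENNReal.ofReal l * cond α W P₂ Q ≠ ⊤ :=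
    (hQ.trans_le le_top).ne
  have hf1 : cond α W P₁ Q ≠ ⊤ := fun h => by
    rw [h, ENNReal.mul_top (ENNReal.ofReal_pos.2 hl0).ne', top_add] at hfin'
    exact hfin' rfl
  have hf2 : cond α W P₂ Q ≠ ⊤ := fun h => by
    rw [h, ENNReal.mul_top (ENNReal.ofReal_pos.2 hl.1).ne', add_top] at hfin'
    exact hfin' rfl
  have hr : rd α q Q ≠ ⊤ := fun h => by
    rw [h, add_top, top_le_iff] at h3
    exact ENNReal.add_ne_top.2 ⟨hf1, ENNReal.ofReal_ne_top⟩ h3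
  refine ⟨Q, hr, hf2, ?_⟩
  have h4 := ENNReal.toReal_mono (ENNReal.add_ne_top.2 ⟨hf1, ENNReal.ofReal_ne_top⟩) h3
  have h5 := ENNReal.toReal_mono (ENNReal.add_ne_top.2 ⟨hfin, ENNReal.ofReal_ne_top⟩) hQ.le
  rw [ENNReal.toReal_add hfin hr, ENNReal.toReal_add hf1 ENNReal.ofReal_ne_top,
    ENNReal.toReal_ofReal he.le] at h4
  rw [ENNReal.toReal_add (ENNReal.mul_ne_top ENNReal.ofReal_ne_top hf1)
    (ENNReal.mul_ne_top ENNReal.ofReal_ne_top hf2), ENNReal.toReal_mul, ENNReal.toReal_mul,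
    ENNReal.toReal_ofReal hl0.le, ENNReal.toReal_ofReal hl.1.le,
    ENNReal.toReal_add hfin ENNReal.ofReal_ne_top, ENNReal.toReal_ofReal he.le] at h5
  nlinarith [mul_le_mul_of_nonneg_left h4 hl0.le, mul_pos hl.1 he]

/-- Means of nearly optimal input distributions are close in the Hellinger distance. -/
lemma hell_mean_le {α : ℝ} (hα : 0 < α) (hα' : α ≤ 1) {W : X → ProbabilityMeasure Y}
    {A : Set (X →₀ ℝ)} (hA : A ⊆ finPMF X) (hconv : Convex ℝ A)
    (hfin : ⨆ P ∈ A, info α W P ≠ ⊤) {P₁ P₂ : X →₀ ℝ} (h₁ : P₁ ∈ A) (h₂ : P₂ ∈ A)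
    {q₁ q₂ : ProbabilityMeasure Y} (hq₁ : ∀ Q, info α W P₁ + rd α q₁ Q ≤ cond α W P₁ Q)
    (hq₂ : ∀ Q, info α W P₂ + rd α q₂ Q ≤ cond α W P₂ Q) {b : ℝ} (hb : 0 < b)
    (hI₁ : ⨆ P ∈ A, info α W P ≤ info α W P₁ + ENNReal.ofReal (gapConst α * b ^ 2))
    (hI₂ : ⨆ P ∈ A, info α W P ≤ info α W P₂ + ENNReal.ofReal (gapConst α * b ^ 2)) :
    hell (q₁ : Measure Y) q₂ ≤ ENNReal.ofReal (6 * b) := by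
  have hc := gapConst_pos hα hα'
  have he : 0 < gapConst α * b ^ 2 := by positivity
  obtain ⟨Q, hr₁, hf₂, hQ⟩ := exists_near_optimal hA hconv hfin h₁ h₂ hq₁ he hI₁
    (l := 1 / 2) ⟨by norm_num, by norm_num⟩
  set C := ⨆ P ∈ A, info α W P with hC
  set e := gapConst α * b ^ 2 with he'
  have h3 : C + rd α q₂ Q ≤ cond α W P₂ Q + ENNReal.ofReal e :=
    calc C + rd α q₂ Q ≤ info α W P₂ + ENNReal.ofReal e + rd α q₂ Q := add_le_add_left hI₂ _
      _ = info α W P₂ + rd α q₂ Q + ENNReal.ofReal e := by ring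
      _ ≤ _ := add_le_add_left (hq₂ Q) _
  have hr₂ : rd α q₂ Q ≠ ⊤ := fun h => by
    rw [h, add_top, top_le_iff] at h3
    exact ENNReal.add_ne_top.2 ⟨hf₂, ENNReal.ofReal_ne_top⟩ h3
  have h4 := ENNReal.toReal_mono (ENNReal.add_ne_top.2 ⟨hf₂, ENNReal.ofReal_ne_top⟩) h3
  rw [ENNReal.toReal_add hfin hr₂, ENNReal.toReal_add hf₂ ENNReal.ofReal_ne_top,
    ENNReal.toReal_ofReal he.le] at h4
  -- At l = 1/2 the errors add up to 2(2e) + e, after replacing the divergence at P₂ by its lower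
  -- bound C + D(q₂‖Q) - e.
  have h5 : (rd α q₁ Q).toReal + (rd α q₂ Q).toReal ≤ 5 * e := by linarith
  have h6 : ∀ q : ProbabilityMeasure Y, rd α q Q ≠ ⊤ → (rd α q Q).toReal ≤ 5 * e →
      hell (q : Measure Y) Q ≤ ENNReal.ofReal (3 * b) := by
    intro q hr hle
    refine hell_le_of_rd_le hα hα' ?_
    rw [← ENNReal.ofReal_pow (by positivity), ← ENNReal.ofReal_mul hc.le]
    refine (ENNReal.le_ofReal_iff_toReal_le hr (by positivity)).2 (hle.trans ?_)
    -- With e = c b², c = `gapConst α`, this is 5 c b² ≤ c (3b)².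
    rw [he']; nlinarith
  have h7 := h6 q₁ hr₁ (by linarith [ENNReal.toReal_nonneg (a := rd α q₂ Q)])
  have h8 := h6 q₂ hr₂ (by linarith [ENNReal.toReal_nonneg (a := rd α q₁ Q)])
  refine (hell_triangle_right _ _ (Q : Measure Y)).trans ((add_le_add h7 h8).trans (le_of_eq ?_))
  rw [← ENNReal.ofReal_add (by positivity) (by positivity)]
  congr 1; ring

/-- Existence of the Augustin center, with the Erven–Harremoës bound. -/
lemma exists_center {α : ℝ} (hα : 0 < α) (hα' : α ≤ 1) {W : X → ProbabilityMeasure Y}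
    {A : Set (X →₀ ℝ)} (hA : A ⊆ finPMF X) (hne : A.Nonempty) (hconv : Convex ℝ A)
    (hfin : ⨆ P ∈ A, info α W P ≠ ⊤) :
    ∃ q : ProbabilityMeasure Y, (∀ P ∈ A, cond α W P q ≤ ⨆ P ∈ A, info α W P) ∧
      ∀ Q : ProbabilityMeasure Y,
        (⨆ P ∈ A, info α W P) + rd α q Q ≤ ⨆ P ∈ A, cond α W P Q := by
  set C := ⨆ P ∈ A, info α W P with hC
  have hc := gapConst_pos hα hα'
  -- The exponent n + 1 keeps b n ≤ 1/2, so that 1 - b n stays away from 0 when b n is the mixing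
  -- weight.
  set b : ℕ → ℝ := fun n => (1 / 2) ^ (n + 1) with hb
  have hb0 : ∀ n, 0 < b n := fun n => by positivity
  have hbhalf : ∀ n, b n ≤ 1 / 2 := fun n => by
    have : (1 / 2 : ℝ) ^ n ≤ 1 := pow_le_one₀ (by norm_num) (by norm_num)
    simp only [hb, pow_succ]; linarith
  have hbanti : ∀ N n, N ≤ n → b n ≤ b N := fun N n h =>
    pow_le_pow_of_le_one (by norm_num) (by norm_num) (by lia)
  have hblim : Tendsto b atTop (𝓝 0) :=
    (tendsto_pow_atTop_nhds_zero_of_lt_one (by norm_num) (by norm_num)).comp (tendsto_add_atTop_nat 1)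
  have he0 : ∀ n, 0 < gapConst α * b n ^ 2 := fun n => by have := hb0 n; positivity
  have hex : ∀ n, ∃ P ∈ A, C ≤ info α W P + ENNReal.ofReal (gapConst α * b n ^ 2) := by
    intro n
    by_cases hC0 : C = 0
    · obtain ⟨P, hP⟩ := hne
      exact ⟨P, hP, by rw [hC0]; exact zero_le⟩
    · have hlt : C - ENNReal.ofReal (gapConst α * b n ^ 2) < C :=
        ENNReal.sub_lt_self hfin hC0 (ENNReal.ofReal_pos.2 (he0 n)).ne'
      obtain ⟨P, hP, hlt'⟩ := lt_biSup_iff.1 (hC ▸ hlt)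
      exact ⟨P, hP, tsub_le_iff_right.1 hlt'.le⟩
  choose P hPA hPI using hex
  have hmean : ∀ n, ∃ q : ProbabilityMeasure Y, ∀ Q : ProbabilityMeasure Y,
      info α W (P n) + rd α q Q ≤ cond α W (P n) Q := fun n =>
    exists_mean_info hα hα' W (hA (hPA n))
      ((le_biSup (info α W) (hPA n)).trans_lt (lt_top_iff_ne_top.2 hfin))
  choose q hq using hmean
  have hcauchy : ∀ N n m : ℕ, N ≤ n → N ≤ m →
      -- The constant 7 instead of 6 provides the strict inequality.
      hell (q n : Measure Y) (q m) < ENNReal.ofReal (7 * b N) := by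
    intro N n m hn hm
    have hmono : ∀ k, N ≤ k → C ≤ info α W (P k) + ENNReal.ofReal (gapConst α * b N ^ 2) :=
      fun k hk => (hPI k).trans (add_le_add_right (ENNReal.ofReal_le_ofReal
        (mul_le_mul_of_nonneg_left (pow_le_pow_left₀ (hb0 k).le (hbanti N k hk) 2) hc.le)) _)
    refine (hell_mean_le hα hα' hA hconv hfin (hPA n) (hPA m) (hq n) (hq m) (hb0 N)
      (hmono n hn) (hmono m hm)).trans_lt ?_
    rw [ENNReal.ofReal_lt_ofReal_iff (by linarith [hb0 N])]
    linarith [hb0 N]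
  have hsum : ∑' n, ENNReal.ofReal (7 * b n) ≠ ∞ := by
    have : Summable fun n => 7 * b n :=
      (((summable_nat_add_iff 1).2 summable_geometric_two)).mul_left 7
    exact this.tsum_ofReal_ne_top
  obtain ⟨q', hq'⟩ := exists_tendsto_hell q _ hsum hcauchy
  refine ⟨q', fun P' hP' => ?_, fun Q => ?_⟩
  -- The weight on P' is b n and the error is of order (b n)². Both the weight and the ratio of
  -- error to weight tend to 0, which gives D(q n‖Q n) → 0 and D(W‖Q n|P') ≤ C + O(b n).
  · have hnear := fun n => exists_near_optimal hA hconv hfin (hPA n) hP' (hq n) (he0 n) (hPI n)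
      (l := b n) ⟨hb0 n, by linarith [hbhalf n]⟩
    choose Q hr hf hQ using hnear
    rw [← hC] at hQ
    have hrd : Tendsto (fun n => rd α (q n) (Q n)) atTop (𝓝 0) := by
      have hlim : Tendsto (fun n => ENNReal.ofReal (2 * (C.toReal * b n + 2 * (gapConst α * b n ^ 2))))
          atTop (𝓝 (ENNReal.ofReal (2 * (C.toReal * 0 + 2 * (gapConst α * 0 ^ 2))))) :=
        ENNReal.tendsto_ofReal (((hblim.const_mul _).add
          (((hblim.pow 2).const_mul _).const_mul 2)).const_mul 2)
      rw [show 2 * (C.toReal * 0 + 2 * (gapConst α * 0 ^ 2)) = 0 by ring, ENNReal.ofReal_zero] at hlim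
      refine tendsto_of_tendsto_of_tendsto_of_le_of_le tendsto_const_nhds hlim
        (fun _ => zero_le) fun n => ?_
      refine (ENNReal.le_ofReal_iff_toReal_le (hr n) ?_).2 ?_
      · have := hb0 n; have := he0 n; have := ENNReal.toReal_nonneg (a := C); positivity
      · have h1 := hQ n
        have h2 : 0 ≤ b n * (cond α W P' (Q n)).toReal :=
          mul_nonneg (hb0 n).le ENNReal.toReal_nonneg
        have h3 := mul_le_mul_of_nonneg_right (hbhalf n)
          (ENNReal.toReal_nonneg (a := rd α (q n) (Q n)))
        linarith
    have hQq : Tendsto (fun n => hell (Q n : Measure Y) q') atTop (𝓝 0) := by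
      have h1 := (tendsto_hell_of_tendsto_rd hα hα' hrd).add hq'
      rw [add_zero] at h1
      refine tendsto_of_tendsto_of_tendsto_of_le_of_le tendsto_const_nhds h1
        (fun _ => zero_le) fun n => ?_
      have h2 := hell_triangle_right (Q n : Measure Y) (q' : Measure Y) (q n : Measure Y)
      rwa [hell_comm (Q n : Measure Y) (q n), hell_comm (q' : Measure Y) (q n)] at h2
    have hu : Tendsto (fun n => ENNReal.ofReal (C.toReal + 2 * (gapConst α * b n))) atTop
        (𝓝 (ENNReal.ofReal (C.toReal + 2 * (gapConst α * 0)))) :=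
      ENNReal.tendsto_ofReal (((hblim.const_mul _).const_mul 2).const_add _)
    rw [mul_zero, mul_zero, add_zero, ENNReal.ofReal_toReal hfin] at hu
    refine cond_le_of_tendsto hα hα' W P' hQq hu fun n => ?_
    refine (ENNReal.le_ofReal_iff_toReal_le (hf n) ?_).2 ?_
    · have := hb0 n; have := ENNReal.toReal_nonneg (a := C); positivity
    · have h1 := hQ n
      have h2 : 0 ≤ (1 - b n) * (rd α (q n) (Q n)).toReal :=
        mul_nonneg (by linarith [hbhalf n]) ENNReal.toReal_nonneg
      refine le_of_mul_le_mul_left ?_ (hb0 n)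
      nlinarith
  · obtain ⟨k, hk, hlsc⟩ := exists_subseq_le_liminf hα hα' hq' (Q : Measure Y)
    have hu : Tendsto (fun n => (⨆ P ∈ A, cond α W P Q) +
        ENNReal.ofReal (gapConst α * b (k n) ^ 2)) atTop
        (𝓝 ((⨆ P ∈ A, cond α W P Q) + ENNReal.ofReal (gapConst α * 0 ^ 2))) :=
      tendsto_const_nhds.add (ENNReal.tendsto_ofReal
        (((hblim.comp hk.tendsto_atTop).pow 2).const_mul _))
    norm_num at hu
    calc C + rd α q' Q ≤ C + liminf (fun n => rd α (q (k n)) Q) atTop :=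
          add_le_add_right (hlsc Q Measure.AbsolutelyContinuous.rfl).2 _
      _ = liminf (fun _ : ℕ => C) atTop + liminf (fun n => rd α (q (k n)) Q) atTop := by
          rw [liminf_const]
      _ ≤ liminf (fun n => C + rd α (q (k n)) Q) atTop := liminf_add_liminf_le _ _
      _ ≤ liminf (fun n => (⨆ P ∈ A, cond α W P Q) +
          ENNReal.ofReal (gapConst α * b (k n) ^ 2)) atTop := by
          refine liminf_le_liminf (Eventually.of_forall fun n => ?_)
          calc C + rd α (q (k n)) Q
              ≤ info α W (P (k n)) + ENNReal.ofReal (gapConst α * b (k n) ^ 2) +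
                rd α (q (k n)) Q := add_le_add_left (hPI (k n)) _
            _ = info α W (P (k n)) + rd α (q (k n)) Q +
                ENNReal.ofReal (gapConst α * b (k n) ^ 2) := by ring
            _ ≤ _ := add_le_add_left ((hq (k n) Q).trans
                (le_biSup (fun P => cond α W P Q) (hPA (k n)))) _
      _ = _ := hu.liminf_eq

end Augustin

/-! ### The theorem with extended real values -/

theorem mainTheorem5 {X Y : Type*} [MeasurableSpace Y] (α : ℝ) (hα : 0 < α) (hα' : α ≤ 1)
    (W : X → ProbabilityMeasure Y) (A : Set (X →₀ ℝ)) (hA : A ⊆ Augustin.finPMF X)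
    (hne : A.Nonempty) (hconv : Convex ℝ A) (hfin : Augustin.augustinCapacity α W A < ⊤) :
    (∃! q : ProbabilityMeasure Y, Augustin.IsAugustinCenter α W A q) ∧
      ∀ q : ProbabilityMeasure Y, Augustin.IsAugustinCenter α W A q →
        ∀ Q : ProbabilityMeasure Y,
          Augustin.augustinCapacity α W A + Augustin.renyiDiv α q Q ≤
            ⨆ P ∈ A, Augustin.condRenyiDiv α W Q P := by
  have hsup : ∀ Q : ProbabilityMeasure Y, (⨆ P ∈ A, Augustin.condRenyiDiv α W Q P) =
      ((⨆ P ∈ A, Augustin.cond α W P Q : ℝ≥0∞) : EReal) := by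
    intro Q
    rw [Augustin.coe_biSup_ennreal hne]
    exact biSup_congr fun P hP => (Augustin.coe_cond hα hα' W (hA hP) Q).symm
  have hcap : Augustin.augustinCapacity α W A =
      ((⨆ P ∈ A, Augustin.info α W P : ℝ≥0∞) : EReal) := by
    rw [Augustin.coe_biSup_ennreal hne]
    refine biSup_congr fun P hP => ?_
    rw [Augustin.info, Augustin.coe_iInf_ennreal]
    exact iInf_congr fun Q => (Augustin.coe_cond hα hα' W (hA hP) Q).symm
  have hfin' : ⨆ P ∈ A, Augustin.info α W P ≠ ⊤ := by
    intro h
    rw [hcap, h] at hfin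
    exact lt_irrefl _ hfin
  obtain ⟨q, hq, hbound⟩ := Augustin.exists_center hα hα' hA hne hconv hfin'
  have hcenter : ∀ r : ProbabilityMeasure Y, Augustin.IsAugustinCenter α W A r ↔
      (⨆ P ∈ A, Augustin.info α W P) = ⨆ P ∈ A, Augustin.cond α W P r := by
    intro r
    rw [Augustin.IsAugustinCenter, hcap, hsup, EReal.coe_ennreal_eq_coe_ennreal_iff]
  have hqc : Augustin.IsAugustinCenter α W A q := (hcenter q).2 <| le_antisymm
    (iSup₂_mono fun P _ => iInf_le _ q) (iSup₂_le hq)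
  have huniq : ∀ r : ProbabilityMeasure Y, Augustin.IsAugustinCenter α W A r → r = q := by
    intro r hr
    -- The bound at Q = r reads C + D(q‖r) ≤ C; finiteness of C allows cancellation.
    have h1 := hbound r
    rw [← (hcenter r).1 hr] at h1
    refine (Augustin.eq_of_rd_eq_zero hα hα' (le_antisymm ?_ zero_le)).symm
    exact (ENNReal.add_le_add_iff_left hfin').1 (by rwa [add_zero])
  refine ⟨⟨q, hqc, huniq⟩, fun r hr Q => ?_⟩
  rw [huniq r hr, hcap, hsup, ← Augustin.coe_rd hα hα', ← EReal.coe_ennreal_add]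
  exact EReal.coe_ennreal_le_coe_ennreal_iff.2 (hbound Q)
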